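/- Let $F$ be a free group on a set $S$ (of any cardinality), let $w\in F$ be a positive element, i.e. a (possibly empty) product of elements of $S$ in which no inverse of a generator occurs, and let $G\cong F/\langle\!\langle w\rangle\!\rangle$ be the corresponding positive one-relator group. For a group $H$, let $H^{(0)}_{\mathbb Q}=H$ and $H^{(i)}_{\mathbb Q}=\{g\in H \mid g^k\in[H^{(i-1)}_{\mathbb Q},H^{(i-1)}_{\mathbb Q}]\text{ for some integer }k\neq 0\}$ for $i\geq 1$ (the rational derived series). Call $H$ $\mathbb Q$-solvable if $H^{(n)}_{\mathbb Q}=1$ for some $n$, residually $\mathbb Q$-solvable if $\bigcap_{i\ge 0}H^{(i)}_{\mathbb Q}=1$, and residually solvable if the terms of its ordinary derived series intersect trivially. Call $H$ free-by-($\mathbb Q$-solvable), respectively free-by-solvable, if it has a normal subgroup $N$ that is a free group (possibly trivial or of infinite rank) such that $H/N$ is $\mathbb Q$-solvable, respectively solvable. 1. If $G$ is torsion-free, then $G$ is free-by-($\mathbb Q$-solvable) and residually $\mathbb Q$-solvable. 2. If $G$ has torsion (a non-trivial element of finite order), then $G$ is free-by-solvable and residually solvable. -/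

import Mathlib

/-- An element of a free group is positive if it is a (possibly empty) product of generators,
i.e. it is spelled by a word in which no inverse of a generator occurs. -/
def IsPositiveWord {α : Type*} (w : FreeGroup α) : Prop :=
  w ∈ Submonoid.closure (Set.range (FreeGroup.of : α → FreeGroup α))

/-- A group is torsion-free if its only element of finite order is the identity.
(Mathlib's `IsMulTorsionFree` is the stronger property that roots are unique.) -/
def IsTorsionFreeGroup (G : Type*) [Group G] : Prop :=
  ∀ g : G, IsOfFinOrder g → g = 1

/-- The elements of a subgroup `H` with a non-trivial power in `[H, H]`, that is, the kernel of
the natural map from `H` to its first homology group over the rationals. -/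
def rationalCommutator {G : Type*} [Group G] (H : Subgroup G) : Subgroup G where
  carrier := {g | g ∈ H ∧ ∃ k : ℤ, k ≠ 0 ∧ g ^ k ∈ ⁅H, H⁆}
  one_mem' := ⟨H.one_mem, 1, one_ne_zero, by simp⟩
  inv_mem' := by
    rintro g ⟨hg, k, hk, h⟩
    exact ⟨H.inv_mem hg, k, hk, by rw [inv_zpow]; exact Subgroup.inv_mem _ h⟩
  mul_mem' := by
    rintro a b ⟨ha, k, hk, hak⟩ ⟨hb, m, hm, hbm⟩
    refine ⟨H.mul_mem ha hb, k * m, mul_ne_zero hk hm, ?_⟩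
    have key : ∀ x : H, (x : G) ∈ ⁅H, H⁆ ↔ Abelianization.of x = 1 := by
      intro x
      rw [← MonoidHom.mem_ker, Abelianization.ker_of, ← Subgroup.map_subtype_commutator]
      simp [Subgroup.mem_map]
    have h1 : (Abelianization.of (⟨a, ha⟩ : H)) ^ k = 1 := by
      rw [← map_zpow, ← key]; simpa using hak
    have h2 : (Abelianization.of (⟨b, hb⟩ : H)) ^ m = 1 := by
      rw [← map_zpow, ← key]; simpa using hbm
    have h3 := (key ((⟨a, ha⟩ * ⟨b, hb⟩) ^ (k * m))).2 (by
      rw [map_zpow, map_mul, mul_zpow, zpow_mul, h1, mul_comm k m, zpow_mul, h2]; simp)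
    simpa using h3

/-- The rational derived series of a group. -/
def rationalDerivedSeries (G : Type*) [Group G] : ℕ → Subgroup G
  | 0 => ⊤
  | n + 1 => rationalCommutator (rationalDerivedSeries G n)

/-- Requiring `g` itself to lie in the previous term is redundant: each term of the rational
derived series consists of all elements of `G` with a non-trivial power in the commutator
subgroup of the previous term. -/
theorem mem_rationalDerivedSeries_succ {G : Type*} [Group G] (n : ℕ) (g : G) :
    g ∈ rationalDerivedSeries G (n + 1) ↔
      ∃ k : ℤ, k ≠ 0 ∧ g ^ k ∈ ⁅rationalDerivedSeries G n, rationalDerivedSeries G n⁆ := by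
  have root : ∀ (n : ℕ) (g : G) (k : ℤ), k ≠ 0 → g ^ k ∈ rationalDerivedSeries G n →
      g ∈ rationalDerivedSeries G n := by
    intro n
    induction n with
    | zero => intro g k _ _; exact Subgroup.mem_top g
    | succ n ih =>
      rintro g k hk ⟨h, m, hm, h'⟩
      exact ⟨ih g k hk h, k * m, mul_ne_zero hk hm, by rwa [zpow_mul]⟩
  constructor
  · exact fun h => h.2
  · rintro ⟨k, hk, h⟩
    exact ⟨root n g k hk (Subgroup.commutator_le_self _ h), k, hk, h⟩

/-- A group is `ℚ`-solvable if its rational derived series reaches the trivial subgroup. -/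
def IsRationallySolvable (G : Type*) [Group G] : Prop :=
  ∃ n : ℕ, rationalDerivedSeries G n = ⊥

/-- A group is residually `ℚ`-solvable if its rational derived series has trivial
intersection. -/
def IsResiduallyRationallySolvable (G : Type*) [Group G] : Prop :=
  (⨅ n : ℕ, rationalDerivedSeries G n) = ⊥

/-- A group is residually solvable if its derived series has trivial intersection. -/
def IsResiduallySolvable (G : Type*) [Group G] : Prop :=
  (⨅ n : ℕ, derivedSeries G n) = ⊥

/-- A group is free-by-(`ℚ`-solvable) if it has a free normal subgroup with `ℚ`-solvable
quotient. -/
def IsFreeByRationallySolvable (G : Type*) [Group G] : Prop :=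
  ∃ (N : Subgroup G) (_ : N.Normal), IsFreeGroup N ∧ IsRationallySolvable (G ⧸ N)

/-- A group is free-by-solvable if it has a free normal subgroup with solvable quotient. -/
def IsFreeBySolvable (G : Type*) [Group G] : Prop :=
  ∃ (N : Subgroup G) (_ : N.Normal), IsFreeGroup N ∧ Group.IsSolvable (G ⧸ N)

/-!
Let `w` be a non-empty positive word, `G` the group it presents, and `D m` the terms of the rational
derived series of `G`. The relator describes a closed path in the Cayley graph of `G ⧸ D m`.

*The path is a simple closed path, run around `k ≥ 1` times.* Choose `m` such that every closed
subpath that is trivial in `G ⧸ D m` is already trivial in `G ⧸ D (m + 1)`, and let `v` be a shortest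
one. If some edge of the path were missing from `v`, there would be labels in `ℚ` of the edges of
the Cayley graph for which all translates of the relator have label `0`, but `v` has not. Such
labels give a homomorphism from `D m` to `ℚ` that does not vanish on `v`, which is absurd. So all
edges belong to the simple closed path `v`, and as `w` is positive, the path can only run around it.
Hence `w = u ^ k`, where the path of `u` is simple (`exists_edge_eq_of_closed_subpath`,
`exists_simple_root`).

*Equations along a simple path are uniquely solvable.* Labels with values in any group for which
the translates of `u` have prescribed labels can be chosen freely at all edges but some, and are then
unique. This rests on `exists_isFreeUnknowns`: finitely many elements of a `ℚ`-solvable group are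
told apart by an integral height function (`exists_height`), and above and below a window of heights
in which the labels are prescribed, an equation determines its label at greatest, respectively
least, height, by recursion. The same fact provides the labels used in the first step.

*A subgroup is free.* Let `M ≤ D m` be the intersection of the kernels of all homomorphisms from
`D m` to `ℤ / k`. By the second step, the action groupoid of `G` on `G ⧸ M` is free: among the labels
of the translates of `u` all can be chosen but one of each orbit of `u`, which has length `k`. So its
vertex group `M` is free (`isFreeGroup_cyclicKernel`). The quotient `G ⧸ M` is solvable. If `G` is
torsion-free, then `k = 1`, because the image of `u` has order `k`, so that `M = D m` and `G ⧸ M` is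
`ℚ`-solvable. The residual properties pass from `M` to `G`, and free groups are residually
`ℚ`-solvable, by the argument of the first step
(`isResiduallyRationallySolvable_freeGroup`).
-/

/-! ### Systems of equations with unique solutions -/

/-- Constraints on a function `ℓ : Z → X` are sorted by a rank, those of rank `n` involving only the
values of `ℓ` at points of rank at most `n`. If the constraints of rank `n` always determine the
values at points of rank `n` in terms of the others, all constraints together determine `ℓ`. -/
theorem existsUnique_of_rank {Z X : Type*} [Nonempty X] (ρ : Z → ℕ) (Q : ℕ → (Z → X) → Prop)
    (dep : ∀ n (ℓ ℓ' : Z → X), (∀ z, ρ z ≤ n → ℓ z = ℓ' z) → Q n ℓ → Q n ℓ')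
    (step : ∀ n (ℓ : Z → X), ∃! ℓ' : Z → X, (∀ z, ρ z ≠ n → ℓ' z = ℓ z) ∧ Q n ℓ') :
    ∃! ℓ, ∀ n, Q n ℓ := by
  choose next hnext huniq using step
  let s : ℕ → Z → X := fun n =>
    Nat.rec (next 0 (fun _ => Classical.arbitrary X)) (fun m ℓ => next (m + 1) ℓ) n
  have hs : ∀ n z, ρ z ≠ n + 1 → s (n + 1) z = s n z := fun n z hz => (hnext (n + 1) (s n)).1 z hz
  have hsQ : ∀ n, Q n (s n) := by
    intro n
    cases n with
    | zero => exact (hnext 0 _).2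
    | succ n => exact (hnext (n + 1) _).2
  have hstab : ∀ z n, ρ z ≤ n → s n z = s (ρ z) z := by
    intro z n hn
    induction n, hn using Nat.le_induction with
    | base => rfl
    | succ n hn ih => rw [hs n z (by omega), ih]
  refine ⟨fun z => s (ρ z) z, fun n => dep n (s n) _ (fun z hz => hstab z n hz) (hsQ n), ?_⟩
  have key : ∀ ℓ₁ ℓ₂ : Z → X, (∀ n, Q n ℓ₁) → (∀ n, Q n ℓ₂) → ∀ n z, ρ z = n → ℓ₁ z = ℓ₂ z := by
    intro ℓ₁ ℓ₂ h₁ h₂ n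
    induction n using Nat.strong_induction_on with
    | _ n ih =>
      intro z hz
      -- `ℓ₁` and `ℓ₂` cut off at rank `n` both solve the step that starts from `ℓ₁`
      have e₁ := huniq n ℓ₁ ℓ₁ ⟨fun _ _ => rfl, h₁ n⟩
      have e₂ := huniq n ℓ₁ (fun z => if ρ z = n then ℓ₂ z else ℓ₁ z)
        ⟨fun z hz => by simp [hz], dep n ℓ₂ _ (fun y hy => by
          split_ifs with h
          · rfl
          · exact (ih (ρ y) (by omega) y rfl).symm) (h₂ n)⟩
      have := congrFun (e₁.trans e₂.symm) z
      simpa [hz] using this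
  intro ℓ hℓ
  funext z
  exact key ℓ _ hℓ (fun n => dep n (s n) _ (fun z hz => hstab z n hz) (hsQ n)) _ z rfl

/-- The equation with index `j` involves the unknowns at the points `pt p j`, `p ∈ P`. A set `R` of
points is a set of free unknowns if, whatever equations with values in `X` of this shape are given,
as long as each is uniquely solvable for each single one of its unknowns, the values on `R` can be
prescribed arbitrarily and then determine a unique solution. -/
def IsFreeUnknowns {ι J Z : Type*} (X : Type*) (pt : ι → J → Z) (P : Finset ι) (R : Set Z) : Prop :=
  ∀ C : J → (Z → X) → Prop,
    (∀ j (ℓ ℓ' : Z → X), (∀ p ∈ P, ℓ (pt p j) = ℓ' (pt p j)) → C j ℓ → C j ℓ') →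
    (∀ j (ℓ : Z → X), ∀ p ∈ P, ∃! y, ∀ ℓ' : Z → X, ℓ' (pt p j) = y →
      (∀ z, z ≠ pt p j → ℓ' z = ℓ z) → C j ℓ') →
    ∀ r : Z → X, ∃! ℓ : Z → X, (∀ z ∈ R, ℓ z = r z) ∧ ∀ j, C j ℓ

/-- The unknowns at which the height is extremal among those of an equation: if these have free
unknowns `R`, the equations of one level determine the values at one height. -/
theorem IsFreeUnknowns.existsUnique_level {ι J Z X : Type*} {pt : ι → J → Z} {P P' : Finset ι}
    {R : Set Z} (hfree : IsFreeUnknowns X pt P' R) (hPP : P' ⊆ P) (ht : Z → ℤ) (β : J → ℤ) (a : ℤ)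
    (hin : ∀ p ∈ P', ∀ j, ht (pt p j) = β j + a)
    (hout : ∀ p ∈ P, p ∉ P' → ∀ j, ht (pt p j) ≠ β j + a)
    (C : J → (Z → X) → Prop)
    (dep : ∀ j (ℓ ℓ' : Z → X), (∀ p ∈ P, ℓ (pt p j) = ℓ' (pt p j)) → C j ℓ → C j ℓ')
    (bij : ∀ j (ℓ : Z → X), ∀ p ∈ P, ∃! y, ∀ ℓ' : Z → X, ℓ' (pt p j) = y →
      (∀ z, z ≠ pt p j → ℓ' z = ℓ z) → C j ℓ')
    (r : Z → X) (b : ℤ) (ℓ : Z → X) :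
    ∃! ℓ' : Z → X, (∀ z, ht z ≠ b + a → ℓ' z = ℓ z) ∧ (∀ z ∈ R, ht z = b + a → ℓ' z = r z) ∧
      ∀ j, β j = b → C j ℓ' := by
  classical
  -- outside the extremal height the values of `ℓ` are used in every equation
  let C' : J → (Z → X) → Prop := fun j m => C j (fun z => if ht z = β j + a then m z else ℓ z)
  obtain ⟨m, ⟨hmR, hmC⟩, hmu⟩ := hfree C' (by
      intro j m m' h
      refine dep j _ _ (fun p hp => ?_)
      by_cases hp' : p ∈ P'
      · simp [hin p hp' j, h p hp']
      · simp [hout p hp hp' j]) (by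
      intro j m p hp
      obtain ⟨y, hy, hyu⟩ := bij j (fun z => if ht z = β j + a then m z else ℓ z) p (hPP hp)
      refine ⟨y, fun m' h1 h2 => hy _ (by simp [hin p hp j, h1]) (fun z hz => by simp [h2 z hz]),
        fun y' hy' => hyu y' (fun m' h1 h2 => ?_)⟩
      refine dep j _ _ (fun q hq => ?_) (hy' (Function.update m (pt p j) y') (by simp)
        (fun z hz => by simp [hz]))
      by_cases hqp : pt q j = pt p j
      · simp [hqp, h1, hin p hp j]
      · simp [h2 _ hqp, hqp]) r
  refine ⟨fun z => if ht z = b + a then m z else ℓ z, ⟨fun z hz => by simp [hz],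
    fun z hz h => by simp [h, hmR z hz], fun j hj => ?_⟩, ?_⟩
  · have := hmC j
    simp only [C', hj] at this
    exact this
  · rintro m' ⟨h1, h2, h3⟩
    have : (fun z => if ht z = b + a then m' z else m z) = m := by
      refine hmu _ ⟨fun z hz => ?_, fun j => ?_⟩
      · dsimp only
        split_ifs with h
        · exact h2 z hz h
        · exact hmR z hz
      · by_cases hj : β j = b
        · refine dep j _ _ (fun p _ => ?_) (h3 j hj)
          by_cases h : ht (pt p j) = b + a
          · simp [h, hj]
          · simp [h, hj, h1 _ h]
        · refine dep j _ _ (fun p _ => ?_) (hmC j)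
          by_cases h : ht (pt p j) = β j + a
          · simp [h, hj]
          · simp [h]
    funext z
    split_ifs with h
    · rw [← this]; simp [h]
    · exact h1 z h

/-- Suppose that for every `P' ⊆ P` with at least two elements there is a height function for which
the points `pt p j`, `p ∈ P'`, differ in height in a way independent of `j`, and not all have the
same height. Then there is a set `R` of free unknowns, which contains all unknowns but one of a
given equation `j₀`.

Induction on `P`: the values at the heights in a window as wide as the equations are prescribed;
above it an equation is used to determine its unknowns of greatest height, below it those of
least height. -/
theorem exists_isFreeUnknowns.{v, u₁, u₂, u₃} {ι : Type u₁} {J : Type u₂} {Z : Type u₃}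
    (pt : ι → J → Z) (j₀ : J)
    (P : Finset ι) (hP : P.Nonempty) (hbij : ∀ p ∈ P, Function.Bijective (pt p))
    (H : ∀ P' ⊆ P, (∃ p ∈ P', ∃ q ∈ P', p ≠ q) → ∃ (ht : Z → ℤ) (β : J → ℤ) (ψ : ι → ℤ),
      (∀ p ∈ P', ∀ j, ht (pt p j) = β j + ψ p) ∧ ∃ p ∈ P', ∃ q ∈ P', ψ p ≠ ψ q) :
    ∃ R : Set Z, (∃ p₁ ∈ P, ∀ p ∈ P, p ≠ p₁ → pt p j₀ ∈ R) ∧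
      ∀ (X : Type v) [Nonempty X], IsFreeUnknowns X pt P R := by
  classical
  induction P using Finset.strongInduction with
  | _ P ih =>
  by_cases hnt : ∃ p ∈ P, ∃ q ∈ P, p ≠ q
  swap
  · obtain ⟨p, hp⟩ := hP
    push Not at hnt
    refine ⟨∅, ⟨p, hp, fun q hq h => (h (hnt q hq p hp)).elim⟩, fun X _ C dep bij r => ?_⟩
    have hb := hbij p hp
    obtain ⟨inv, hil, hir⟩ := Function.bijective_iff_has_inverse.1 hb
    choose y hy hyu using fun j => bij j r p hp
    refine ⟨fun z => y (inv z), ⟨by simp, fun j => ?_⟩, ?_⟩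
    · refine dep j _ _ (fun q hq => ?_) (hy j (Function.update r (pt p j) (y j)) (by simp)
        (fun z hz => by simp [hz]))
      simp [hnt q hq p hp, hil j]
    · rintro ℓ ⟨-, hℓ⟩
      funext z
      have hz := hir z
      have := hyu (inv z) (ℓ z) (fun ℓ' h1 _ => by
        refine dep _ ℓ _ (fun q hq => ?_) (hℓ (inv z))
        rw [hnt q hq p hp, h1, hz])
      exact this
  · obtain ⟨ht₀, β₀, ψ, hht₀, p₂, hp₂, q₂, hq₂, hne⟩ := H P subset_rfl hnt
    -- normalize the heights so that the equation `j₀` has level `0`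
    obtain ⟨ht, β, hht, hβ⟩ : ∃ (ht : Z → ℤ) (β : J → ℤ),
        (∀ p ∈ P, ∀ j, ht (pt p j) = β j + ψ p) ∧ β j₀ = 0 :=
      ⟨fun z => ht₀ z - β₀ j₀, fun j => β₀ j - β₀ j₀,
        fun p hp j => by dsimp only; rw [hht₀ p hp j]; ring, by simp⟩
    obtain ⟨pt', hpt', ht_max⟩ := P.exists_max_image ψ hP
    obtain ⟨pb, hpb, hb_min⟩ := P.exists_min_image ψ hP
    set t := ψ pt' with ht_def
    set s := ψ pb with hs_def
    have hst : s < t := by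
      have := ht_max p₂ hp₂; have := ht_max q₂ hq₂
      have := hb_min p₂ hp₂; have := hb_min q₂ hq₂
      omega
    have sub : ∀ a : ℤ, P.filter (fun p => ψ p = a) ⊆ P := fun a => Finset.filter_subset _ _
    have ssub : ∀ a : ℤ, P.filter (fun p => ψ p = a) ⊂ P := by
      intro a
      refine (Finset.filter_ssubset).2 ?_
      by_cases h : ψ p₂ = a
      · exact ⟨q₂, hq₂, fun h' => hne (h.trans h'.symm)⟩
      · exact ⟨p₂, hp₂, h⟩
    obtain ⟨Rt, ⟨p₁, hp₁, hRt⟩, hft⟩ := ih (P.filter (fun p => ψ p = t)) (ssub t)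
      ⟨pt', by simp [hpt', ht_def]⟩ (fun p hp => hbij p (sub t hp))
      (fun P' hP' => H P' (hP'.trans (sub t)))
    obtain ⟨Rb, -, hfb⟩ := ih (P.filter (fun p => ψ p = s)) (ssub s)
      ⟨pb, by simp [hpb, hs_def]⟩ (fun p hp => hbij p (sub s hp))
      (fun P' hP' => H P' (hP'.trans (sub s)))
    let R : Set Z := {z | (s ≤ ht z ∧ ht z < t) ∨ (t ≤ ht z ∧ z ∈ Rt) ∨ (ht z < s ∧ z ∈ Rb)}
    refine ⟨R, ⟨p₁, sub t hp₁, fun p hp hpp => ?_⟩, fun X _ C dep bij r => ?_⟩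
    · have h1 := hht p hp j₀
      have h2 := ht_max p hp
      have h3 := hb_min p hp
      by_cases h : ψ p = t
      · exact Or.inr (Or.inl ⟨by omega, hRt p (by simp [hp, h]) hpp⟩)
      · exact Or.inl ⟨by omega, by omega⟩
    -- the window has rank `0`, the heights above and below it alternate in rank
    let ρ : Z → ℕ := fun z =>
      if ht z < s then (2 * (s - ht z)).toNat
      else if t ≤ ht z then (2 * (ht z - t) + 1).toNat else 0
    let e : J → ℕ := fun j => if 0 ≤ β j then (2 * β j + 1).toNat else (-2 * β j).toNat
    let Q : ℕ → (Z → X) → Prop := fun n ℓ =>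
      (∀ z ∈ R, ρ z = n → ℓ z = r z) ∧ ∀ j, e j = n → C j ℓ
    have hrank : ∀ j, ∀ p ∈ P, ρ (pt p j) ≤ e j := by
      intro j p hp
      have h1 := hht p hp j
      have h2 := ht_max p hp
      have h3 := hb_min p hp
      simp only [ρ, e]
      split_ifs <;> omega
    have hin : ∀ a : ℤ, ∀ p ∈ P.filter (fun p => ψ p = a), ∀ j, ht (pt p j) = β j + a := by
      intro a p hp j
      rw [Finset.mem_filter] at hp
      rw [hht p hp.1 j, hp.2]
    have hout : ∀ a : ℤ, ∀ p ∈ P, p ∉ P.filter (fun p => ψ p = a) →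
        ∀ j, ht (pt p j) ≠ β j + a := by
      intro a p hp hpa j
      rw [Finset.mem_filter] at hpa
      rw [hht p hp j]
      intro h
      exact hpa ⟨hp, by linarith⟩
    obtain ⟨ℓ, hℓ, hu⟩ := existsUnique_of_rank ρ Q (by
        rintro n ℓ ℓ' h ⟨h1, h2⟩
        refine ⟨fun z hz hn => by rw [← h z hn.le, h1 z hz hn], fun j hj => ?_⟩
        exact dep j ℓ ℓ' (fun p hp => h _ ((hrank j p hp).trans hj.le)) (h2 j hj)) (by
        intro n ℓ
        rcases Nat.even_or_odd' n with ⟨m, rfl | rfl⟩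
        · rcases Nat.eq_zero_or_pos m with rfl | hm
          · refine ⟨fun z => if ρ z = 0 then r z else ℓ z, ⟨fun z hz => if_neg hz,
              fun z _ hz => if_pos hz, fun j hj => ?_⟩, ?_⟩
            · exfalso
              simp only [e] at hj
              split_ifs at hj <;> omega
            · rintro ℓ' ⟨h1, h2, -⟩
              funext z
              split_ifs with hz
              · refine h2 z (Or.inl ?_) hz
                simp only [ρ] at hz
                split_ifs at hz <;> omega
              · exact h1 z hz
          · obtain ⟨ℓ', ⟨h1, h2, h3⟩, h4⟩ := (hfb X).existsUnique_level (sub s) ht β s (hin s)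
              (hout s) C dep bij r (-m) ℓ
            have hρ : ∀ z, ρ z = 2 * m ↔ ht z = -m + s := by
              intro z
              simp only [ρ]
              split_ifs <;> omega
            have he : ∀ j, e j = 2 * m ↔ β j = -m := by
              intro j
              simp only [e]
              split_ifs <;> omega
            have hR : ∀ z, ht z = -m + s → (z ∈ R ↔ z ∈ Rb) := by
              intro z hz
              have a1 : ¬ (s ≤ ht z) := by omega
              have a2 : ¬ (t ≤ ht z) := by omega
              have a3 : ht z < s := by omega
              simp only [R, Set.mem_ofPred_eq, a1, a2, a3, false_and, true_and, false_or]
            refine ⟨ℓ', ⟨fun z hz => h1 z (by rwa [Ne, ← hρ]), fun z hz hn => ?_, fun j hj => ?_⟩,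
              ?_⟩
            · rw [hρ] at hn
              exact h2 z ((hR z hn).1 hz) hn
            · exact h3 j ((he j).1 hj)
            · rintro ℓ'' ⟨g1, g2, g3⟩
              exact h4 ℓ'' ⟨fun z hz => g1 z (by rwa [Ne, hρ]),
                fun z hz hn => g2 z ((hR z hn).2 hz) ((hρ z).2 hn), fun j hj => g3 j ((he j).2 hj)⟩
        · obtain ⟨ℓ', ⟨h1, h2, h3⟩, h4⟩ := (hft X).existsUnique_level (sub t) ht β t (hin t)
            (hout t) C dep bij r m ℓ
          have hρ : ∀ z, ρ z = 2 * m + 1 ↔ ht z = m + t := by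
            intro z
            simp only [ρ]
            split_ifs <;> first | omega | (rw [false_iff]; omega)
          have he : ∀ j, e j = 2 * m + 1 ↔ β j = m := by
            intro j
            simp only [e]
            split_ifs <;> omega
          have hR : ∀ z, ht z = m + t → (z ∈ R ↔ z ∈ Rt) := by
            intro z hz
            have a1 : ¬ (ht z < t) := by omega
            have a2 : t ≤ ht z := by omega
            have a3 : ¬ (ht z < s) := by omega
            simp only [R, Set.mem_ofPred_eq, a1, a2, a3, false_and, and_false, true_and, false_or,
              or_false]
          refine ⟨ℓ', ⟨fun z hz => h1 z (by rwa [Ne, ← hρ]), fun z hz hn => ?_, fun j hj => ?_⟩,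
            ?_⟩
          · rw [hρ] at hn
            exact h2 z ((hR z hn).1 hz) hn
          · exact h3 j ((he j).1 hj)
          · rintro ℓ'' ⟨g1, g2, g3⟩
            exact h4 ℓ'' ⟨fun z hz => g1 z (by rwa [Ne, hρ]),
              fun z hz hn => g2 z ((hR z hn).2 hz) ((hρ z).2 hn), fun j hj => g3 j ((he j).2 hj)⟩)
    exact ⟨ℓ, ⟨fun z hz => (hℓ (ρ z)).1 z hz rfl, fun j => (hℓ (e j)).2 j rfl⟩,
      fun ℓ' h => hu ℓ' fun n => ⟨fun z hz _ => h.1 z hz, fun j _ => h.2 j⟩⟩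

/-! ### The rational derived series -/

theorem mem_rationalDerivedSeries_of_zpow_mem {G : Type*} [Group G] {n : ℕ} {g : G} {k : ℤ}
    (hk : k ≠ 0) (h : g ^ k ∈ rationalDerivedSeries G n) : g ∈ rationalDerivedSeries G n := by
  cases n with
  | zero => exact Subgroup.mem_top g
  | succ n =>
    obtain ⟨m, hm, h'⟩ := (mem_rationalDerivedSeries_succ n _).1 h
    exact (mem_rationalDerivedSeries_succ n _).2 ⟨k * m, mul_ne_zero hk hm, by rwa [zpow_mul]⟩

theorem commutator_le_rationalDerivedSeries_succ {G : Type*} [Group G] (n : ℕ) :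
    ⁅rationalDerivedSeries G n, rationalDerivedSeries G n⁆ ≤ rationalDerivedSeries G (n + 1) :=
  fun g hg => (mem_rationalDerivedSeries_succ n g).2 ⟨1, one_ne_zero, by simpa using hg⟩

theorem rationalDerivedSeries_antitone (G : Type*) [Group G] :
    Antitone (rationalDerivedSeries G) :=
  antitone_nat_of_succ_le fun _ _ hg => hg.1

theorem derivedSeries_le_rationalDerivedSeries (G : Type*) [Group G] (n : ℕ) :
    derivedSeries G n ≤ rationalDerivedSeries G n := by
  induction n with
  | zero => exact le_top
  | succ n ih =>
    exact (Subgroup.commutator_mono ih ih).trans (commutator_le_rationalDerivedSeries_succ n)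

theorem map_mem_rationalDerivedSeries {G H : Type*} [Group G] [Group H] (f : G →* H) {n : ℕ}
    {g : G} (hg : g ∈ rationalDerivedSeries G n) : f g ∈ rationalDerivedSeries H n := by
  induction n generalizing g with
  | zero => exact Subgroup.mem_top _
  | succ n ih =>
    obtain ⟨k, hk, h⟩ := (mem_rationalDerivedSeries_succ n _).1 hg
    refine (mem_rationalDerivedSeries_succ n _).2 ⟨k, hk, ?_⟩
    have hle : (rationalDerivedSeries G n).map f ≤ rationalDerivedSeries H n := by
      rintro _ ⟨x, hx, rfl⟩
      exact ih hx
    rw [← map_zpow]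
    refine Subgroup.commutator_mono hle hle ?_
    rw [← Subgroup.map_commutator]
    exact Subgroup.mem_map_of_mem f h

instance rationalDerivedSeries_normal (G : Type*) [Group G] (n : ℕ) :
    (rationalDerivedSeries G n).Normal :=
  ⟨fun _ hg a => map_mem_rationalDerivedSeries (MulAut.conj a).toMonoidHom hg⟩

theorem rationalDerivedSeries_eq_bot_of_injective {G H : Type*} [Group G] [Group H] (f : G →* H)
    (hf : Function.Injective f) {n : ℕ} (h : rationalDerivedSeries H n = ⊥) :
    rationalDerivedSeries G n = ⊥ := by
  refine (Subgroup.eq_bot_iff_forall _).2 fun g hg => hf ?_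
  have := map_mem_rationalDerivedSeries f hg
  rw [h, Subgroup.mem_bot] at this
  rw [this, map_one]

theorem rationalDerivedSeries_quotient (G : Type*) [Group G] (n : ℕ) :
    rationalDerivedSeries (G ⧸ rationalDerivedSeries G n) n = ⊥ := by
  set N := rationalDerivedSeries G n with hN
  have key : ∀ m ≤ n, rationalDerivedSeries (G ⧸ N) m ≤
      (rationalDerivedSeries G m).map (QuotientGroup.mk' N) := by
    intro m hm
    induction m with
    | zero =>
      rintro ⟨g⟩ -
      exact ⟨g, Subgroup.mem_top g, rfl⟩
    | succ m ih =>
      intro q hq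
      obtain ⟨g, rfl⟩ := QuotientGroup.mk'_surjective N q
      obtain ⟨k, hk, h⟩ := (mem_rationalDerivedSeries_succ m _).1 hq
      have h1 := Subgroup.commutator_mono (ih (by omega)) (ih (by omega)) h
      rw [← Subgroup.map_commutator, ← map_zpow] at h1
      obtain ⟨c, hc, hcg⟩ := h1
      refine ⟨g, mem_rationalDerivedSeries_of_zpow_mem hk ?_, rfl⟩
      have h2 : c⁻¹ * g ^ k ∈ N := by
        rw [← QuotientGroup.eq]
        exact hcg
      have h3 := mul_mem (commutator_le_rationalDerivedSeries_succ m hc)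
        (rationalDerivedSeries_antitone G hm h2)
      simpa using h3
  rw [eq_bot_iff]
  refine (key n le_rfl).trans ?_
  rintro _ ⟨g, hg, rfl⟩
  exact (QuotientGroup.eq_one_iff g).2 hg

/-- A finite set of elements does not notice the step from some term of the rational derived series
to the next one. -/
theorem exists_mem_rationalDerivedSeries_succ {G : Type*} [Group G] (S : Finset G) :
    ∃ m, ∀ g ∈ S, g ∈ rationalDerivedSeries G m → g ∈ rationalDerivedSeries G (m + 1) := by
  have key : ∀ g : G, ∃ m₀, ∀ m ≥ m₀,
      g ∈ rationalDerivedSeries G m → g ∈ rationalDerivedSeries G (m + 1) := by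
    intro g
    by_cases h : ∀ m, g ∈ rationalDerivedSeries G m
    · exact ⟨0, fun m _ _ => h (m + 1)⟩
    · push Not at h
      obtain ⟨m₀, hm₀⟩ := h
      exact ⟨m₀, fun m hm hg => (hm₀ (rationalDerivedSeries_antitone G hm hg)).elim⟩
  choose m₀ hm₀ using key
  exact ⟨S.sup m₀, fun g hg => hm₀ g _ (Finset.le_sup hg)⟩

theorem map_eq_one_of_mem_rationalCommutator {G : Type*} [Group G] {H : Subgroup G}
    (h : H →* Multiplicative ℚ) (g : H) (hg : (g : G) ∈ rationalCommutator H) : h g = 1 := by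
  obtain ⟨-, k, hk, hgk⟩ := hg
  rw [← Subgroup.map_subtype_commutator] at hgk
  obtain ⟨c, hc, hcg⟩ := hgk
  have h1 : h c = 1 := Abelianization.commutator_subset_ker h hc
  have h2 : c = g ^ k := Subtype.ext hcg
  rw [h2, map_zpow] at h1
  have h3 : k * (h g).toAdd = 0 := by
    simpa using congrArg Multiplicative.toAdd h1
  have h4 := (mul_eq_zero.1 h3).resolve_left (by exact_mod_cast hk)
  exact Multiplicative.toAdd.injective h4

theorem exists_monoidHom_rat_ne_one {G : Type*} [Group G] {H : Subgroup G} (g : H)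
    (hg : (g : G) ∉ rationalCommutator H) : ∃ h : H →* Multiplicative ℚ, h g ≠ 1 := by
  let A := Additive (Abelianization H)
  let a : A := Additive.ofMul (Abelianization.of g)
  have ha : (TensorProduct.mk ℤ ℚ A 1) a ≠ 0 := by
    have : IsLocalizedModule (nonZeroDivisors ℤ) (TensorProduct.mk ℤ ℚ A 1) :=
      (isLocalizedModule_iff_isBaseChange (nonZeroDivisors ℤ) ℚ _).2
        (TensorProduct.isBaseChange ℤ A ℚ)
    rw [Ne, IsLocalizedModule.eq_zero_iff (nonZeroDivisors ℤ)]
    rintro ⟨⟨k, hk⟩, h⟩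
    refine hg ⟨g.2, k, nonZeroDivisors.ne_zero hk, ?_⟩
    have h1 : Abelianization.of (g ^ k) = 1 := by
      rw [map_zpow]
      exact h
    rw [← MonoidHom.mem_ker, Abelianization.ker_of] at h1
    rw [← Subgroup.map_subtype_commutator]
    exact ⟨g ^ k, h1, by simp⟩
  obtain ⟨φ, hφ⟩ := Module.Projective.exists_dual_ne_zero ℚ ha
  let ψ : A →+ ℚ := φ.toAddMonoidHom.comp (TensorProduct.mk ℤ ℚ A 1).toAddMonoidHom
  refine ⟨(AddMonoidHom.toMultiplicativeRight ψ).comp Abelianization.of, fun h => hφ ?_⟩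
  exact congrArg Multiplicative.toAdd h

/-- Finitely many elements of a `ℚ`-solvable group are told apart by a height function: the elements
`p x`, `p ∈ P`, differ in height in a way independent of `x`, and not all have the same height.

All `p q⁻¹` lie in some term `H` of the series, but not in the next one, so that a homomorphism from
`H` to `ℚ` is not trivial on them. It extends to the right cosets of `H`, and is made integral by
clearing the denominators of its values at the `p q⁻¹` and rounding down. -/
theorem exists_height {Γ : Type*} [Group Γ] {n : ℕ} (hΓ : rationalDerivedSeries Γ n = ⊥)
    (P : Finset Γ) (hP : ∃ p ∈ P, ∃ q ∈ P, p ≠ q) :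
    ∃ (ht β ψ : Γ → ℤ), (∀ p ∈ P, ∀ x, ht (p * x) = β x + ψ p) ∧
      ∃ p ∈ P, ∃ q ∈ P, ψ p ≠ ψ q := by
  classical
  obtain ⟨p₀, hp₀, q₀, hq₀, hne⟩ := hP
  obtain ⟨i, hi, hi'⟩ : ∃ i, (∀ p ∈ P, p * p₀⁻¹ ∈ rationalDerivedSeries Γ i) ∧
      ¬ ∀ p ∈ P, p * p₀⁻¹ ∈ rationalDerivedSeries Γ (i + 1) := by
    by_contra! hcon
    have : ∀ i, ∀ p ∈ P, p * p₀⁻¹ ∈ rationalDerivedSeries Γ i := by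
      intro i
      induction i with
      | zero => exact fun p _ => Subgroup.mem_top _
      | succ i ih => exact hcon i ih
    have h := this n q₀ hq₀
    rw [hΓ, Subgroup.mem_bot, mul_inv_eq_one] at h
    exact hne h.symm
  set H := rationalDerivedSeries Γ i with hH
  push Not at hi'
  obtain ⟨p₁, hp₁, hp₁'⟩ := hi'
  obtain ⟨h, hh⟩ := exists_monoidHom_rat_ne_one (H := H) ⟨_, hi p₁ hp₁⟩ hp₁'
  let rep : Γ → Γ := fun z => (Quotient.mk (QuotientGroup.rightRel H) z).out
  have hrep : ∀ z, z * (rep z)⁻¹ ∈ H := fun z =>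
    QuotientGroup.rightRel_apply.1 (Quotient.exact (Quotient.out_eq _))
  have hrep' : ∀ a ∈ H, ∀ z, rep (a * z) = rep z := by
    intro a ha z
    refine congrArg Quotient.out (Quotient.sound (QuotientGroup.rightRel_apply.2 ?_))
    simpa using inv_mem ha
  let htq : Γ → ℚ := fun z => (h ⟨_, hrep z⟩).toAdd
  have hhtq : ∀ (a : Γ) (ha : a ∈ H) (z : Γ), htq (a * z) = (h ⟨a, ha⟩).toAdd + htq z := by
    intro a ha z
    simp only [htq]
    rw [← toAdd_mul, ← map_mul]
    congr 2
    refine Subtype.ext ?_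
    simp only [Subgroup.coe_mul, hrep' a ha, mul_assoc]
  let d : Γ → ℚ := fun p => if hp : p ∈ P then (h ⟨_, hi p hp⟩).toAdd else 0
  let N : ℕ := ∏ p ∈ P, (d p).den
  have hN : N ≠ 0 := Finset.prod_ne_zero_iff.2 fun p _ => (d p).den_ne_zero
  have hint : ∀ p ∈ P, ∃ a : ℤ, N * d p = a := by
    intro p hp
    obtain ⟨m, hm⟩ : (d p).den ∣ N := Finset.dvd_prod_of_mem _ hp
    refine ⟨m * (d p).num, ?_⟩
    rw [hm]
    push_cast
    rw [mul_comm ((d p).den : ℚ), mul_assoc, Rat.den_mul_eq_num]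
  choose! ψ hψ using hint
  refine ⟨fun z => ⌊(N : ℚ) * htq z⌋, fun x => ⌊(N : ℚ) * htq (p₀ * x)⌋, ψ, fun p hp x => ?_,
    p₁, hp₁, p₀, hp₀, fun hcon => hh ?_⟩
  · have h1 : p * x = (p * p₀⁻¹) * (p₀ * x) := by group
    have h2 : (h ⟨_, hi p hp⟩).toAdd = d p := by simp [d, hp]
    dsimp only
    rw [h1, hhtq _ (hi p hp), h2, mul_add, hψ p hp, Int.floor_intCast_add, add_comm]
  · have h0 : d p₀ = 0 := by
      have : (⟨p₀ * p₀⁻¹, hi p₀ hp₀⟩ : H) = 1 := Subtype.ext (mul_inv_cancel p₀)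
      simp only [d, hp₀, dif_pos, this, map_one, toAdd_one]
    have h1 : N * d p₁ = 0 := by rw [hψ p₁ hp₁, hcon, ← hψ p₀ hp₀, h0, mul_zero]
    have h2 := (mul_eq_zero.1 h1).resolve_left (by exact_mod_cast hN)
    have h3 : d p₁ = (h ⟨_, hi p₁ hp₁⟩).toAdd := by simp [d, hp₁]
    rw [h3] at h2
    exact Multiplicative.toAdd.injective h2

/-! ### Cocycles -/

/-- A (non-abelian) cocycle: a map that assigns to `g` and a point `x` a label in `X` of the arrow
from `x` to `g • x`, compatibly with composition of arrows. -/
def IsCocycle {G Z X : Type*} [Group G] [MulAction G Z] [Group X] (κ : G → Z → X) : Prop :=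
  ∀ g h x, κ (g * h) x = κ g (h • x) * κ h x

namespace IsCocycle

variable {G Z X : Type*} [Group G] [MulAction G Z] [Group X] {κ : G → Z → X}

theorem map_one (h : IsCocycle κ) (x : Z) : κ 1 x = 1 := by
  have := h 1 1 x
  rw [one_smul, mul_one] at this
  exact mul_eq_left.1 this.symm

theorem map_inv (h : IsCocycle κ) (g : G) (x : Z) : κ g⁻¹ x = (κ g (g⁻¹ • x))⁻¹ := by
  have := h g g⁻¹ x
  rw [mul_inv_cancel, h.map_one] at this
  exact eq_inv_of_mul_eq_one_right this.symm

theorem map_mul_inv (h : IsCocycle κ) (g k : G) (x : Z) :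
    κ (g * k⁻¹) (k • x) = κ g x * (κ k x)⁻¹ := by
  rw [h, h.map_inv, inv_smul_smul]

theorem eq_of_forall_generator {α : Type*} {κ' : G → Z → X} (h : IsCocycle κ) (h' : IsCocycle κ')
    {f : FreeGroup α →* G} (hf : Function.Surjective f)
    (heq : ∀ s, κ (f (FreeGroup.of s)) = κ' (f (FreeGroup.of s))) : κ = κ' := by
  funext g
  obtain ⟨v, rfl⟩ := hf g
  induction v using FreeGroup.induction_on with
  | C1 => funext x; rw [_root_.map_one, h.map_one, h'.map_one]
  | of s => exact heq s
  | inv_of s _ => funext x; rw [_root_.map_inv, h.map_inv, h'.map_inv, heq]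
  | mul v w hv hw => funext x; rw [map_mul, h, h', hv, hw]

end IsCocycle

theorem exists_isCocycle_freeGroup {α G Z X : Type*} [Group G] [MulAction G Z] [Group X]
    (f : FreeGroup α →* G) (ℓ : α → Z → X) :
    ∃ κ : FreeGroup α → Z → X, (∀ v w x, κ (v * w) x = κ v (f w • x) * κ w x) ∧
      ∀ s, κ (FreeGroup.of s) = ℓ s := by
  let Φ : FreeGroup α →* (Z → X) ⋊[mulAutArrow] G := FreeGroup.lift fun s =>
    ⟨fun y => ℓ s ((f (FreeGroup.of s))⁻¹ • y), f (FreeGroup.of s)⟩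
  have hΦ : ∀ v, (Φ v).right = f v := by
    intro v
    have : SemidirectProduct.rightHom.comp Φ = f := FreeGroup.ext_hom _ _ fun s => by simp [Φ]
    exact DFunLike.congr_fun this v
  refine ⟨fun v x => (Φ v).left (f v • x), fun v w x => ?_, fun s => ?_⟩
  · dsimp only
    rw [map_mul Φ, SemidirectProduct.mul_left, hΦ, map_mul f, mul_smul]
    change (Φ v).left _ * (Φ w).left ((f v)⁻¹ • f v • f w • x) = _
    rw [inv_smul_smul]
  · funext x
    simp [Φ]

/-- Labels of the generators extend to a cocycle on a one-relator group if the relator has trivial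
label at every point. -/
theorem exists_isCocycle {α G Z X : Type*} [Group G] [MulAction G Z] [Group X]
    {f : FreeGroup α →* G} (hf : Function.Surjective f) {w : FreeGroup α}
    (hker : f.ker = Subgroup.normalClosure {w}) {κ : FreeGroup α → Z → X}
    (hκ : ∀ v w x, κ (v * w) x = κ v (f w • x) * κ w x) (hw : ∀ x, κ w x = 1) :
    ∃ κ' : G → Z → X, IsCocycle κ' ∧ ∀ v, κ' (f v) = κ v := by
  let act : MulAction (FreeGroup α) Z := MulAction.compHom Z f
  have hκ' : IsCocycle κ := hκ
  have hsmul : ∀ (v : FreeGroup α) (x : Z), v • x = f v • x := fun _ _ => rfl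
  let K : Subgroup (FreeGroup α) :=
    { carrier := {v | f v = 1 ∧ ∀ x, κ v x = 1}
      one_mem' := ⟨map_one f, hκ'.map_one⟩
      mul_mem' := by
        rintro a b ⟨ha, ha'⟩ ⟨hb, hb'⟩
        exact ⟨by rw [map_mul, ha, hb, one_mul], fun x => by rw [hκ, ha', hb', one_mul]⟩
      inv_mem' := by
        rintro a ⟨ha, ha'⟩
        exact ⟨by rw [map_inv, ha, inv_one], fun x => by rw [hκ'.map_inv, ha', inv_one]⟩ }
  have hK : K.Normal := ⟨by
    rintro a ⟨ha, ha'⟩ g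
    refine ⟨by rw [map_mul, map_mul, ha, mul_one, map_inv, mul_inv_cancel], fun x => ?_⟩
    rw [hκ, hκ, ha', mul_one, ha, one_smul, hκ'.map_inv, hsmul, mul_inv_cancel]⟩
  have hkerK : f.ker ≤ K := by
    rw [hker]
    refine Subgroup.normalClosure_le_normal ?_
    rintro _ rfl
    refine ⟨?_, hw⟩
    rw [← MonoidHom.mem_ker, hker]
    exact Subgroup.subset_normalClosure rfl
  have hwell : ∀ v v', f v = f v' → κ v = κ v' := by
    intro v v' h
    have hz : v⁻¹ * v' ∈ K := hkerK (by rw [MonoidHom.mem_ker, map_mul, map_inv, h, inv_mul_cancel])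
    funext x
    have := hκ v (v⁻¹ * v') x
    rw [mul_inv_cancel_left, hz.1, one_smul, hz.2, mul_one] at this
    exact this.symm
  choose sec hsec using hf
  refine ⟨fun g => κ (sec g), fun g h x => ?_, fun v => hwell _ _ (hsec _)⟩
  dsimp only
  rw [hwell (sec (g * h)) (sec g * sec h) (by simp [hsec]), hκ, hsec]

theorem smul_quotient_eq_mul {G : Type*} [Group G] (N : Subgroup G) [N.Normal] (g : G)
    (y : G ⧸ N) : g • y = (g : G ⧸ N) * y := by
  induction y using QuotientGroup.induction_on with
  | H a => rfl

/-- A normal subgroup `N` acts trivially on `G ⧸ N`, so that a cocycle on `G ⧸ N`, at a given point,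
is a homomorphism on `N`. -/
def IsCocycle.restrict {G X : Type*} [Group G] [Group X] {N : Subgroup G} [N.Normal]
    {κ : G → G ⧸ N → X} (hκ : IsCocycle κ) (y : G ⧸ N) : N →* X where
  toFun a := κ a y
  map_one' := hκ.map_one y
  map_mul' a b := by
    have : (b : G) • y = y := by
      rw [smul_quotient_eq_mul, (QuotientGroup.eq_one_iff (b : G)).2 b.2, one_mul]
    rw [Subgroup.coe_mul, hκ, this]

/-- A rational cocycle on a quotient by a term of the rational derived series is a homomorphism to
`ℚ` on this term, and vanishes on the next one. -/
theorem IsCocycle.eq_one_of_mem_rationalDerivedSeries {G : Type*} [Group G] {m : ℕ}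
    {κ : G → G ⧸ rationalDerivedSeries G m → Multiplicative ℚ} (hκ : IsCocycle κ) {z : G}
    (hz : z ∈ rationalDerivedSeries G (m + 1)) (y : G ⧸ rationalDerivedSeries G m) :
    κ z y = 1 :=
  map_eq_one_of_mem_rationalCommutator (hκ.restrict y) ⟨z, hz.1⟩ hz

/-! ### Positive words -/

/-- The positive element `c (t - 1) * ⋯ * c 1 * c 0` of a free group. -/
def genProd {α : Type*} (c : ℕ → α) : ℕ → FreeGroup α
  | 0 => 1
  | t + 1 => FreeGroup.of (c t) * genProd c t

theorem exists_genProd {α : Type*} {w : FreeGroup α} (hw : IsPositiveWord w) (h1 : w ≠ 1) :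
    ∃ (c : ℕ → α) (n : ℕ), 0 < n ∧ w = genProd c n := by
  have key : w = 1 ∨ ∃ (c : ℕ → α) (n : ℕ), 0 < n ∧ w = genProd c n := by
    clear h1
    induction hw using Submonoid.closure_induction_left with
    | one => exact Or.inl rfl
    | mul_left x hx y hy ih =>
      obtain ⟨s, rfl⟩ := hx
      right
      rcases ih with rfl | ⟨c, n, hn, rfl⟩
      · exact ⟨fun _ => s, 1, one_pos, rfl⟩
      · classical
        have key : ∀ t ≤ n, genProd (Function.update c n s) t = genProd c t := by
          intro t ht
          induction t with
          | zero => rfl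
          | succ t ih => simp only [genProd]; rw [ih (by omega), Function.update_of_ne (by omega)]
        refine ⟨Function.update c n s, n + 1, n.succ_pos, ?_⟩
        simp only [genProd]
        rw [key n le_rfl, Function.update_self]
  exact key.resolve_left h1

theorem genProd_congr {α : Type*} {c c' : ℕ → α} {n : ℕ} (h : ∀ t < n, c t = c' t) :
    genProd c n = genProd c' n := by
  induction n with
  | zero => rfl
  | succ n ih => rw [genProd, genProd, h n (by omega), ih fun t ht => h t (by omega)]

theorem genProd_add {α : Type*} (c : ℕ → α) (s t : ℕ) :
    genProd c (t + s) = genProd (fun i => c (i + s)) t * genProd c s := by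
  induction t with
  | zero => simp [genProd]
  | succ t ih => rw [Nat.add_right_comm, genProd, ih, genProd, mul_assoc]

theorem genProd_eq_pow {α : Type*} {c : ℕ → α} {d k : ℕ} (h : ∀ t < d * k, c t = c (t % d)) :
    genProd c (d * k) = genProd c d ^ k := by
  induction k with
  | zero => simp [genProd]
  | succ k ih =>
    rw [mul_add_one, add_comm, genProd_add, ih fun t ht => h t (by rw [mul_add_one]; omega),
      pow_succ', genProd_congr (c' := c)]
    intro t ht
    rw [h (t + d * k) (by rw [mul_add_one]; omega), Nat.add_mul_mod_self_left,
      Nat.mod_eq_of_lt ht]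

/-- The label of a positive element is the product of the labels of its letters. -/
theorem cocycle_genProd_eq_sum {α G Z : Type*} [Group G] [MulAction G Z] {f : FreeGroup α →* G}
    {ℓ : α → Z → Multiplicative ℚ} {κ : FreeGroup α → Z → Multiplicative ℚ}
    (hκ : ∀ v w x, κ (v * w) x = κ v (f w • x) * κ w x) (hℓ : ∀ s, κ (FreeGroup.of s) = ℓ s)
    (c : ℕ → α) (t : ℕ) (x : Z) :
    (κ (genProd c t) x).toAdd =
      ∑ τ ∈ Finset.range t, (ℓ (c τ) (f (genProd c τ) • x)).toAdd := by
  induction t with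
  | zero =>
    have := hκ 1 1 x
    rw [map_one, one_smul, mul_one] at this
    simp [genProd, mul_eq_left.1 this.symm]
  | succ t ih => rw [Finset.sum_range_succ, ← ih, genProd, hκ, hℓ, toAdd_mul, add_comm]

/-! ### A relator runs around a simple closed path -/

/-- A solution of a single equation extends to a solution of all equations. -/
theorem IsFreeUnknowns.exists_extension {ι J Z X : Type*} {pt : ι → J → Z} {P : Finset ι}
    {R : Set Z} (hfree : IsFreeUnknowns X pt P R) {j₀ : J} {p₁ : ι} (hp₁ : p₁ ∈ P)
    (hR : ∀ p ∈ P, p ≠ p₁ → pt p j₀ ∈ R) (C : J → (Z → X) → Prop)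
    (dep : ∀ j (ℓ ℓ' : Z → X), (∀ p ∈ P, ℓ (pt p j) = ℓ' (pt p j)) → C j ℓ → C j ℓ')
    (bij : ∀ j (ℓ : Z → X), ∀ p ∈ P, ∃! y, ∀ ℓ' : Z → X, ℓ' (pt p j) = y →
      (∀ z, z ≠ pt p j → ℓ' z = ℓ z) → C j ℓ')
    (r : Z → X) (hr : C j₀ r) :
    ∃ ℓ : Z → X, (∀ p ∈ P, ℓ (pt p j₀) = r (pt p j₀)) ∧ ∀ j, C j ℓ := by
  obtain ⟨ℓ, ⟨hℓR, hℓC⟩, -⟩ := hfree C dep bij r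
  have h1 : ℓ (pt p₁ j₀) = r (pt p₁ j₀) := by
    refine (bij j₀ ℓ p₁ hp₁).unique (fun ℓ' h h' => ?_) (fun ℓ' h h' => ?_)
    · refine dep j₀ ℓ ℓ' (fun p _ => ?_) (hℓC j₀)
      by_cases hp : pt p j₀ = pt p₁ j₀
      · rw [hp, h]
      · rw [h' _ hp]
    · refine dep j₀ r ℓ' (fun p hp => ?_) hr
      by_cases hpp : pt p j₀ = pt p₁ j₀
      · rw [hpp, h]
      · rw [h' _ hpp, hℓR _ (hR p hp fun e => hpp (by rw [e]))]
  refine ⟨ℓ, fun p hp => ?_, hℓC⟩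
  by_cases hpp : p = p₁
  · rw [hpp, h1]
  · exact hℓR _ (hR p hp hpp)

/-- Consider the path `t ↦ g t` that a relator `genProd c n` describes in the Cayley graph of the
quotient by the term `m` of the rational derived series. If a closed subpath, from time `i` to time
`j`, is already trivial in the quotient by the next term, it traverses all edges of the path.

Otherwise an edge of the subpath is given the label `1`, an edge that the subpath misses a label
for which the relator gets label `0`, and all other edges of the path the label `0`. This extends to
all edges so that all translates of the relator get label `0`, and yields a homomorphism from the
term `m` of the series to `ℚ`, which is positive on the subpath. -/
theorem exists_edge_eq_of_closed_subpath {α G : Type*} [Group G] {f : FreeGroup α →* G}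
    (hf : Function.Surjective f) {c : ℕ → α} {n : ℕ}
    (hker : f.ker = Subgroup.normalClosure {genProd c n}) {m i j : ℕ} (hij : i < j) (hjn : j ≤ n)
    (hz : f (genProd c j) * (f (genProd c i))⁻¹ ∈ rationalDerivedSeries G (m + 1))
    {t : ℕ} (ht : t < n) :
    ∃ τ, i ≤ τ ∧ τ < j ∧ c τ = c t ∧
      (f (genProd c τ) : G ⧸ rationalDerivedSeries G m) = f (genProd c t) := by
  classical
  let Γ := G ⧸ rationalDerivedSeries G m
  let g : ℕ → Γ := fun t => (f (genProd c t) : Γ)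
  by_contra! hcon
  change ∀ τ, i ≤ τ → τ < j → c τ = c t → g τ ≠ g t at hcon
  set x := c t with hx
  -- the label of the edge that is missed, as computed from the multiplicities of both edges
  let m₁ : ℚ := ((Finset.range n).filter (fun τ => c τ = c i ∧ g τ = g i)).card
  let m₂ : ℚ := ((Finset.range n).filter (fun τ => c τ = x ∧ g τ = g t)).card
  let ℓ₀ : α → Γ → ℚ := fun s z =>
    (if s = c i ∧ z = g i then 1 else 0) + (if s = x ∧ z = g t then -(m₁ / m₂) else 0)
  have hm₂ : m₂ ≠ 0 := by
    have : t ∈ (Finset.range n).filter (fun τ => c τ = x ∧ g τ = g t) := by simp [ht, hx]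
    exact Nat.cast_ne_zero.2 (Finset.card_ne_zero_of_mem this)
  have hsum₀ : ∑ τ ∈ Finset.range n, ℓ₀ (c τ) (g τ) = 0 := by
    simp only [ℓ₀, Finset.sum_add_distrib]
    rw [← Finset.sum_filter, ← Finset.sum_filter, Finset.sum_const, Finset.sum_const, nsmul_eq_mul,
      nsmul_eq_mul]
    change m₁ * 1 + m₂ * -(m₁ / m₂) = 0
    field_simp
    ring
  let lab : (Γ → ℚ) → α → Γ → ℚ := fun ℓ s z => if s = x then ℓ z else ℓ₀ s z
  let C : Γ → (Γ → ℚ) → Prop := fun y ℓ => ∑ τ ∈ Finset.range n, lab ℓ (c τ) (g τ * y) = 0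
  let P : Finset Γ := ((Finset.range n).filter (fun τ => c τ = x)).image g
  have hP : ∀ τ < n, c τ = x → g τ ∈ P := fun τ h h' =>
    Finset.mem_image_of_mem g (by simp [h, h'])
  obtain ⟨R, ⟨p₁, hp₁, hR⟩, hfree⟩ := exists_isFreeUnknowns.{0} (fun p y : Γ => p * y) 1 P
    ⟨g t, hP t ht rfl⟩ (fun p _ => Group.mulLeft_bijective p)
    (fun P' _ h => exists_height (rationalDerivedSeries_quotient G m) P' h)
  obtain ⟨ℓ, hℓ, hℓC⟩ := (hfree ℚ).exists_extension hp₁ hR C (by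
      intro y ℓ ℓ' h hC
      refine Eq.trans (Finset.sum_congr rfl fun τ hτ => ?_) hC
      simp only [lab]
      split_ifs with hs
      · exact (h _ (hP τ (Finset.mem_range.1 hτ) hs)).symm
      · rfl) (by
      intro y ℓ p hp
      obtain ⟨τ₀, hτ₀, rfl⟩ := Finset.mem_image.1 hp
      rw [Finset.mem_filter, Finset.mem_range] at hτ₀
      set T := (Finset.range n).filter (fun τ => c τ = x ∧ g τ = g τ₀) with hT
      have hTc : (T.card : ℚ) ≠ 0 :=
        Nat.cast_ne_zero.2 (Finset.card_ne_zero_of_mem (by simp [hT, hτ₀] : τ₀ ∈ T))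
      set A : ℚ := ∑ τ ∈ (Finset.range n).filter (fun τ => ¬ (c τ = x ∧ g τ = g τ₀)),
        lab ℓ (c τ) (g τ * y) with hA
      have hform : ∀ (v : ℚ) (ℓ' : Γ → ℚ), ℓ' (g τ₀ * y) = v →
          (∀ z, z ≠ g τ₀ * y → ℓ' z = ℓ z) → (C y ℓ' ↔ T.card * v + A = 0) := by
        intro v ℓ' h1 h2
        have e1 : ∑ τ ∈ T, lab ℓ' (c τ) (g τ * y) = T.card * v := by
          rw [← nsmul_eq_mul]
          refine Finset.sum_eq_card_nsmul fun τ hτ => ?_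
          obtain ⟨h3, h4⟩ := (Finset.mem_filter.1 hτ).2
          simp only [lab, h3, h4, if_true, h1]
        have e2 : ∑ τ ∈ (Finset.range n).filter (fun τ => ¬ (c τ = x ∧ g τ = g τ₀)),
            lab ℓ' (c τ) (g τ * y) = A := by
          refine Finset.sum_congr rfl fun τ hτ => ?_
          have h3 := (Finset.mem_filter.1 hτ).2
          simp only [lab]
          split_ifs with hs
          · exact h2 _ fun h => h3 ⟨hs, mul_right_cancel h⟩
          · rfl
        simp only [C]
        rw [← Finset.sum_filter_add_sum_filter_not _ (fun τ => c τ = x ∧ g τ = g τ₀), e1, e2]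
      refine ⟨-A / T.card, fun ℓ' h1 h2 => (hform _ ℓ' h1 h2).2 (by field_simp; ring),
        fun v hv => ?_⟩
      have h1 := (hform v (Function.update ℓ (g τ₀ * y) v) (by simp)
        (fun z hz => by simp [hz])).1 (hv _ (by simp) (fun z hz => by simp [hz]))
      field_simp
      linarith) (ℓ₀ x) (by
      refine Eq.trans (Finset.sum_congr rfl fun τ _ => ?_) hsum₀
      simp only [lab, mul_one]
      split_ifs with hs
      · rw [hs]
      · rfl)
  obtain ⟨κ, hκ, hκℓ⟩ := exists_isCocycle_freeGroup f
    (fun s (z : Γ) => Multiplicative.ofAdd (lab ℓ s z))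
  obtain ⟨κ', hκ', hκκ'⟩ := exists_isCocycle hf hker hκ (fun y => by
    refine Multiplicative.toAdd.injective ?_
    rw [cocycle_genProd_eq_sum hκ hκℓ]
    simp only [toAdd_ofAdd, toAdd_one]
    exact hℓC y)
  have hlab : ∀ τ < n, lab ℓ (c τ) (g τ) = ℓ₀ (c τ) (g τ) := by
    intro τ hτ
    simp only [lab]
    split_ifs with hs
    · have := hℓ _ (hP τ hτ hs)
      rw [mul_one] at this
      rw [this, hs]
    · rfl
  have hpart : ∀ t ≤ n, (κ' (f (genProd c t)) 1).toAdd =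
      ∑ τ ∈ Finset.range t, ℓ₀ (c τ) (g τ) := by
    intro t ht
    rw [hκκ', cocycle_genProd_eq_sum hκ hκℓ]
    refine Finset.sum_congr rfl fun τ hτ => ?_
    rw [smul_quotient_eq_mul, mul_one, toAdd_ofAdd, ← hlab τ (by
      have := Finset.mem_range.1 hτ; omega)]
  have hzero := hκ'.eq_one_of_mem_rationalDerivedSeries hz (f (genProd c i) • 1)
  rw [hκ'.map_mul_inv] at hzero
  have hzero' := congrArg Multiplicative.toAdd hzero
  rw [← div_eq_mul_inv, toAdd_div, hpart j hjn, hpart i (by omega), toAdd_one,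
    ← Finset.sum_Ico_eq_sub _ hij.le] at hzero'
  have hpos : 0 < ∑ τ ∈ Finset.Ico i j, ℓ₀ (c τ) (g τ) := by
    have hval : ∀ τ ∈ Finset.Ico i j,
        ℓ₀ (c τ) (g τ) = if c τ = c i ∧ g τ = g i then 1 else 0 := by
      intro τ hτ
      rw [Finset.mem_Ico] at hτ
      have : ¬ (c τ = x ∧ g τ = g t) := fun h => hcon τ hτ.1 hτ.2 h.1 h.2
      simp only [ℓ₀, this, if_false, add_zero]
    rw [Finset.sum_congr rfl hval]
    refine Finset.sum_pos' (fun τ _ => by split_ifs <;> norm_num)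
      ⟨i, Finset.mem_Ico.2 ⟨le_rfl, hij⟩, by simp⟩
  exact hpos.ne' hzero'

/-- A closed path `g` of length `n`, with edges labelled by `c`, all of whose edges are traversed by
a simple closed subpath of length `j - i`, runs around it periodically. -/
theorem periodic_of_edges_mem_subpath {α Γ : Type*} {c : ℕ → α} {g : ℕ → Γ} {n i j : ℕ}
    (hij : i < j) (hjn : j ≤ n) (hclosed : g i = g j) (hgn : g n = g 0)
    (hnext : ∀ t t', c t = c t' → g t = g t' → g (t + 1) = g (t' + 1))
    (hinj : ∀ a b, i ≤ a → a < b → b < j → g a ≠ g b)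
    (hedge : ∀ t < n, ∃ τ, i ≤ τ ∧ τ < j ∧ c τ = c t ∧ g τ = g t) :
    (j - i) ∣ n ∧ (∀ t < n, c t = c (t % (j - i))) ∧ g (j - i) = g 0 ∧
      ∀ a b, a < b → b < j - i → g a ≠ g b := by
  set d := j - i with hd
  have hd0 : 0 < d := by omega
  have hinj' : ∀ a b, a < d → b < d → g (i + a) = g (i + b) → a = b := by
    intro a b ha hb h
    rcases lt_trichotomy a b with hab | hab | hab
    · exact (hinj (i + a) (i + b) (by omega) (by omega) (by omega) h).elim
    · exact hab
    · exact (hinj (i + b) (i + a) (by omega) (by omega) (by omega) h.symm).elim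
  obtain ⟨τ₀, h0i, h0j, h0c, h0g⟩ := hedge 0 (by omega)
  -- at time `t` the path is at the position `(a + t) % d` of the subpath
  obtain ⟨a, ha⟩ : ∃ a, τ₀ = i + a := ⟨τ₀ - i, by omega⟩
  have hstep : ∀ b, b < d → g (i + (b + 1) % d) = g (i + b + 1) := by
    intro b hb
    rcases Nat.lt_or_ge (b + 1) d with h | h
    · rw [Nat.mod_eq_of_lt h, add_assoc]
    · have : b + 1 = d := by omega
      rw [this, Nat.mod_self, add_zero, hclosed]
      congr 1
      omega
  have hc : ∀ t, t < n → g t = g (i + (a + t) % d) → c t = c (i + (a + t) % d) := by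
    intro t ht h
    obtain ⟨τ, h1, h2, h3, h4⟩ := hedge t ht
    obtain ⟨b, rfl⟩ : ∃ b, τ = i + b := ⟨τ - i, by omega⟩
    have : b = (a + t) % d := hinj' _ _ (by omega) (Nat.mod_lt _ hd0) (h4.trans h)
    rw [← h3, this]
  have hg : ∀ t ≤ n, g t = g (i + (a + t) % d) := by
    intro t ht
    induction t with
    | zero => rw [add_zero, Nat.mod_eq_of_lt (by omega), ← ha, h0g]
    | succ t ih =>
      have h1 := ih (by omega)
      rw [hnext t _ (hc t (by omega) h1) h1, ← hstep _ (Nat.mod_lt _ hd0), ← add_assoc,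
        Nat.mod_add_mod]
  have hdn : d ∣ n := by
    have h1 := hg n le_rfl
    rw [hgn, hg 0 (by omega)] at h1
    have h2 : a + 0 ≡ a + n [MOD d] := hinj' _ _ (Nat.mod_lt _ hd0) (Nat.mod_lt _ hd0) h1
    exact (Nat.modEq_zero_iff_dvd.1 (Nat.ModEq.add_left_cancel' a h2).symm)
  refine ⟨hdn, fun t ht => ?_, ?_, fun b b' hbb hb' h => ?_⟩
  · have hlt : t % d ≤ t := Nat.mod_le _ _
    rw [hc t ht (hg t ht.le), hc (t % d) (by omega) (hg _ (by omega)), Nat.add_mod_mod]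
  · rw [hg d (by omega), hg 0 (by omega)]
    simp
  · rw [hg b (by omega), hg b' (by omega)] at h
    have h2 : a + b ≡ a + b' [MOD d] := hinj' _ _ (Nat.mod_lt _ hd0) (Nat.mod_lt _ hd0) h
    have h3 := Nat.ModEq.add_left_cancel' a h2
    rw [Nat.ModEq, Nat.mod_eq_of_lt (by omega), Nat.mod_eq_of_lt hb'] at h3
    omega

/-- A positive relator is a power of a positive element which lies in some term `m` of the rational
derived series and describes a simple closed path in the Cayley graph of the quotient. -/
theorem exists_simple_root {α G : Type*} [Group G] {f : FreeGroup α →* G}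
    (hf : Function.Surjective f) {c : ℕ → α} {n : ℕ} (hn : 0 < n)
    (hker : f.ker = Subgroup.normalClosure {genProd c n}) :
    ∃ m d k : ℕ, 0 < d ∧ 0 < k ∧ genProd c n = genProd c d ^ k ∧
      f (genProd c d) ∈ rationalDerivedSeries G m ∧
      ∀ a b, a < b → b < d →
        (f (genProd c a) : G ⧸ rationalDerivedSeries G m) ≠ f (genProd c b) := by
  classical
  obtain ⟨m, hm⟩ := exists_mem_rationalDerivedSeries_succ
    ((Finset.range (n + 1) ×ˢ Finset.range (n + 1)).image
      fun q => f (genProd c q.2) * (f (genProd c q.1))⁻¹)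
  let g : ℕ → G ⧸ rationalDerivedSeries G m := fun t => f (genProd c t)
  have hgn : g n = g 0 := by
    have : f (genProd c n) = 1 := by
      rw [← MonoidHom.mem_ker, hker]
      exact Subgroup.subset_normalClosure rfl
    simp only [g, this, genProd, map_one]
  -- a shortest closed subpath
  have hex : ∃ d, 0 < d ∧ ∃ i, i + d ≤ n ∧ g i = g (i + d) :=
    ⟨n, hn, 0, by omega, by rw [zero_add, hgn]⟩
  obtain ⟨hd0, i, hin, hclosed⟩ := Nat.find_spec hex
  set d := Nat.find hex with hd
  obtain ⟨⟨k, hk⟩, h2, h3, h4⟩ := periodic_of_edges_mem_subpath (c := c) (g := g) (n := n)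
    (i := i) (j := i + d) (by omega) hin hclosed hgn (by
      intro t t' hc hg
      change ((f (genProd c (t + 1)) : G) : G ⧸ rationalDerivedSeries G m) =
        (f (genProd c (t' + 1)) : G)
      rw [genProd, genProd, map_mul, map_mul, QuotientGroup.mk_mul, QuotientGroup.mk_mul, hc]
      exact congrArg _ hg) (by
      intro a b ha hab hb h
      refine Nat.find_min hex (m := b - a) (by omega) ⟨by omega, a, by omega, ?_⟩
      rwa [Nat.add_sub_cancel' hab.le]) (by
      intro t ht
      refine exists_edge_eq_of_closed_subpath hf hker (by omega) hin ?_ ht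
      refine hm _ (Finset.mem_image.2 ⟨(i, i + d), by simp; omega, rfl⟩) ?_
      rw [← QuotientGroup.eq_one_iff, QuotientGroup.mk_mul, QuotientGroup.mk_inv,
        mul_inv_eq_one]
      exact hclosed.symm)
  rw [Nat.add_sub_cancel_left] at hk h2 h3 h4
  refine ⟨m, d, k, hd0, Nat.pos_of_ne_zero ?_, ?_, ?_, h4⟩
  · rintro rfl
    omega
  · rw [hk]
    exact genProd_eq_pow fun t ht => h2 t (by omega)
  · rw [← QuotientGroup.eq_one_iff]
    refine h3.trans ?_
    simp [g, genProd]

/-! ### Labels of a simple closed path -/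

/-- The product of the labels of the edges of the path of `genProd c t` that starts at `y`. -/
def pathLabel {α G Z X : Type*} [Group G] [MulAction G Z] [Group X] (f : FreeGroup α →* G)
    (c : ℕ → α) (ℓ : α → Z → X) : ℕ → Z → X
  | 0, _ => 1
  | t + 1, y => ℓ (c t) (f (genProd c t) • y) * pathLabel f c ℓ t y

section pathLabel

variable {α G Z X : Type*} [Group G] [MulAction G Z] [Group X] {f : FreeGroup α →* G} {c : ℕ → α}

theorem cocycle_genProd {ℓ : α → Z → X} {κ : FreeGroup α → Z → X}
    (hκ : ∀ v w x, κ (v * w) x = κ v (f w • x) * κ w x) (hℓ : ∀ s, κ (FreeGroup.of s) = ℓ s)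
    (t : ℕ) (y : Z) : κ (genProd c t) y = pathLabel f c ℓ t y := by
  induction t with
  | zero =>
    have := hκ 1 1 y
    rw [map_one, one_smul, mul_one] at this
    exact mul_eq_left.1 this.symm
  | succ t ih => rw [genProd, hκ, hℓ, ih, pathLabel]

theorem pathLabel_congr {ℓ ℓ' : α → Z → X} {t : ℕ} {y : Z}
    (h : ∀ τ < t, ℓ (c τ) (f (genProd c τ) • y) = ℓ' (c τ) (f (genProd c τ) • y)) :
    pathLabel f c ℓ t y = pathLabel f c ℓ' t y := by
  induction t with
  | zero => rfl
  | succ t ih => rw [pathLabel, pathLabel, h t (by omega), ih fun τ hτ => h τ (by omega)]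

theorem exists_pathLabel_eq_mul_mul (ℓ : α → Z → X) {t₀ t : ℕ} (ht : t₀ < t) (y : Z) :
    ∃ A B : X, ∀ ℓ' : α → Z → X, (∀ τ < t, τ ≠ t₀ →
      ℓ' (c τ) (f (genProd c τ) • y) = ℓ (c τ) (f (genProd c τ) • y)) →
        pathLabel f c ℓ' t y = A * ℓ' (c t₀) (f (genProd c t₀) • y) * B := by
  induction t, ht using Nat.le_induction with
  | base =>
    refine ⟨1, pathLabel f c ℓ t₀ y, fun ℓ' h => ?_⟩
    rw [pathLabel, one_mul, pathLabel_congr fun τ hτ => h τ (by omega) (by omega)]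
  | succ t ht ih =>
    obtain ⟨A, B, hAB⟩ := ih
    refine ⟨ℓ (c t) (f (genProd c t) • y) * A, B, fun ℓ' h => ?_⟩
    rw [pathLabel, h t (by omega) (by omega), hAB ℓ' fun τ hτ h' => h τ (by omega) h']
    simp only [mul_assoc]

end pathLabel

/-- If `genProd c d` describes a simple path in the Cayley graph of `G ⧸ rationalDerivedSeries G m`,
then its value at all points of a finer quotient can be prescribed by a choice of the labels, and
this choice is unique if the labels for all generators but `c 0`, and those for `c 0` at a suitable
set of points, are given. -/
theorem exists_free_labels.{v, u₁, u₂} {α : Type u₁} {G : Type u₂} [Group G]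
    (f : FreeGroup α →* G) {c : ℕ → α} {m d : ℕ} (hd : 0 < d) (hsimple : ∀ a b, a < b → b < d →
      (f (genProd c a) : G ⧸ rationalDerivedSeries G m) ≠ f (genProd c b))
    (N : Subgroup G) [N.Normal] (hN : N ≤ rationalDerivedSeries G m) :
    ∃ R : Set (G ⧸ N), ∀ (X : Type v) [Group X] (ℓ₀ : α → G ⧸ N → X) (v : G ⧸ N → X),
      ∃! ℓ : α → G ⧸ N → X, (∀ s y, s ≠ c 0 ∨ y ∈ R → ℓ s y = ℓ₀ s y) ∧
        ∀ y, pathLabel f c ℓ d y = v y := by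
  classical
  let π : G ⧸ N →* G ⧸ rationalDerivedSeries G m := QuotientGroup.map N _ (MonoidHom.id G) hN
  have hπ : ∀ (a : G) (y : G ⧸ N), π (a • y) = (a : G ⧸ rationalDerivedSeries G m) * π y := by
    intro a y
    rw [smul_quotient_eq_mul, map_mul]
    rfl
  have hne : ∀ a < d, ∀ b < d, a ≠ b → ∀ y : G ⧸ N,
      f (genProd c a) • y ≠ f (genProd c b) • y := by
    intro a ha b hb hab y h
    have h1 := congrArg π h
    rw [hπ, hπ] at h1
    have h2 := mul_right_cancel h1
    rcases lt_or_gt_of_ne hab with h3 | h3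
    · exact hsimple a b h3 hb h2
    · exact hsimple b a h3 ha h2.symm
  let P : Finset ℕ := (Finset.range d).filter (fun t => c t = c 0)
  have hP : ∀ t, t ∈ P ↔ t < d ∧ c t = c 0 := fun t => by simp [P]
  obtain ⟨R, -, hfree⟩ := exists_isFreeUnknowns.{v}
    (fun t (y : G ⧸ N) => f (genProd c t) • y) 1 P ⟨0, (hP 0).2 ⟨hd, rfl⟩⟩
    (fun t _ => MulAction.bijective _) (by
      rintro P' hP' ⟨a, ha, b, hb, hab⟩
      have hP'' : ∀ t ∈ P', t < d := fun t ht => ((hP t).1 (hP' ht)).1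
      have hne' : (f (genProd c a) : G ⧸ rationalDerivedSeries G m) ≠ f (genProd c b) := by
        rcases lt_or_gt_of_ne hab with h3 | h3
        · exact hsimple a b h3 (hP'' b hb)
        · exact (hsimple b a h3 (hP'' a ha)).symm
      obtain ⟨ht, β, ψ, h1, p, hp, q, hq, hpq⟩ := exists_height
        (rationalDerivedSeries_quotient G m)
        (P'.image fun t => (f (genProd c t) : G ⧸ rationalDerivedSeries G m))
        ⟨_, Finset.mem_image_of_mem _ ha, _, Finset.mem_image_of_mem _ hb, hne'⟩
      obtain ⟨a', ha', rfl⟩ := Finset.mem_image.1 hp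
      obtain ⟨b', hb', rfl⟩ := Finset.mem_image.1 hq
      refine ⟨fun z => ht (π z), fun y => β (π y), fun t => ψ (f (genProd c t) : G),
        fun t ht' y => ?_, a', ha', b', hb', hpq⟩
      dsimp only
      rw [hπ, h1 _ (Finset.mem_image_of_mem _ ht')])
  refine ⟨R, fun X _ ℓ₀ v => ?_⟩
  let ext : (G ⧸ N → X) → α → G ⧸ N → X := fun ℓ s => if s = c 0 then ℓ else ℓ₀ s
  obtain ⟨ℓ, ⟨hℓR, hℓv⟩, hℓu⟩ := hfree X (fun y ℓ => pathLabel f c (ext ℓ) d y = v y) (by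
      intro y ℓ ℓ' h h'
      rw [← h']
      refine pathLabel_congr fun τ hτ => ?_
      simp only [ext]
      split_ifs with hs
      · exact (h τ ((hP τ).2 ⟨hτ, hs⟩)).symm
      · rfl) (by
      intro y ℓ t ht
      obtain ⟨htd, htc⟩ := (hP t).1 ht
      obtain ⟨A, B, hAB⟩ := exists_pathLabel_eq_mul_mul (f := f) (c := c) (ext ℓ) htd y
      have hform : ∀ (x : X) (ℓ' : G ⧸ N → X), ℓ' (f (genProd c t) • y) = x →
          (∀ z, z ≠ f (genProd c t) • y → ℓ' z = ℓ z) →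
            pathLabel f c (ext ℓ') d y = A * x * B := by
        intro x ℓ' h1 h2
        rw [hAB (ext ℓ') fun τ hτ hτt => ?_]
        · simp only [ext, htc, if_true, h1]
        · simp only [ext]
          split_ifs with hs
          · exact h2 _ (hne τ hτ t htd hτt y)
          · rfl
      refine ⟨A⁻¹ * v y * B⁻¹, fun ℓ' h1 h2 => ?_, fun x hx => ?_⟩
      · rw [hform _ ℓ' h1 h2]
        group
      · have h1 := hx (Function.update ℓ (f (genProd c t) • y) x) (by simp)
          (fun z hz => by simp [hz])
        rw [hform x _ (by simp) (fun z hz => by simp [hz])] at h1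
        rw [← h1]
        group) (ℓ₀ (c 0))
  refine ⟨ext ℓ, ⟨fun s y h => ?_, hℓv⟩, ?_⟩
  · simp only [ext]
    split_ifs with hs
    · rw [hs, hℓR y (h.resolve_left fun h' => h' hs)]
    · rfl
  · rintro ℓ' ⟨h1, h2⟩
    have h3 : ext (ℓ' (c 0)) = ℓ' := by
      funext s y
      simp only [ext]
      split_ifs with hs
      · rw [hs]
      · exact (h1 s y (Or.inl hs)).symm
    have h4 : ℓ' (c 0) = ℓ := hℓu _ ⟨fun z hz => h1 _ z (Or.inr hz), fun y => by
      rw [h3, h2]⟩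
    rw [← h3, h4]

/-! ### Orbits of a power -/

/-- The label of `a ^ j` at `y`, where `v` gives the labels of `a`. -/
def orbitProd {G Z X : Type*} [Group G] [MulAction G Z] [Group X] (a : G) (v : Z → X) : ℕ → Z → X
  | 0, _ => 1
  | j + 1, y => v (a ^ j • y) * orbitProd a v j y

section orbitProd

variable {G Z X : Type*} [Group G] [MulAction G Z] [Group X] {a : G} {v : Z → X}

theorem IsCocycle.map_pow {κ : G → Z → X} (hκ : IsCocycle κ) (a : G) (j : ℕ) (y : Z) :
    κ (a ^ j) y = orbitProd a (κ a) j y := by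
  induction j with
  | zero => rw [pow_zero, hκ.map_one, orbitProd]
  | succ j ih => rw [pow_succ', hκ, ih, orbitProd]

theorem orbitProd_succ' (j : ℕ) (y : Z) :
    orbitProd a v (j + 1) y = orbitProd a v j (a • y) * v y := by
  induction j with
  | zero => simp [orbitProd]
  | succ j ih => rw [orbitProd, ih, orbitProd, smul_smul, ← pow_succ, mul_assoc]

theorem orbitProd_congr {v' : Z → X} {j : ℕ} {y : Z}
    (h : ∀ i < j, v (a ^ i • y) = v' (a ^ i • y)) : orbitProd a v j y = orbitProd a v' j y := by
  induction j with
  | zero => rfl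
  | succ j ih => rw [orbitProd, orbitProd, h j (by omega), ih fun i hi => h i (by omega)]

theorem orbitProd_smul_eq_one_iff {k : ℕ} (hk : ∀ y : Z, a ^ k • y = y) (y : Z) :
    orbitProd a v k (a • y) = 1 ↔ orbitProd a v k y = 1 := by
  have h : orbitProd a v k (a • y) = v y * orbitProd a v k y * (v y)⁻¹ := by
    rw [eq_mul_inv_iff_mul_eq, ← orbitProd_succ', orbitProd, hk]
  rw [h, conj_eq_one_iff]

/-- If all orbits of `a` have length `k`, labels of `a` for which `a ^ k` has label `1` can be
prescribed at all points but one of each orbit, and are then unique. -/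
theorem exists_free_orbit_labels.{v, u₁, u₂} {G : Type u₁} {Z : Type u₂} [Group G] [MulAction G Z]
    (a : G) {k : ℕ} (hk0 : 0 < k)
    (hfree : ∀ j : ℕ, 0 < j → j < k → ∀ y : Z, a ^ j • y ≠ y) (hk : ∀ y : Z, a ^ k • y = y) :
    ∃ S : Set Z, ∀ (X : Type v) [Group X] (v₀ : Z → X), ∃! v : Z → X,
      (∀ y, y ∉ S → v y = v₀ y) ∧ ∀ y, orbitProd a v k y = 1 := by
  classical
  let rep : Z → Z := fun y =>
    (Quotient.mk (MulAction.orbitRel (Subgroup.zpowers a) Z) y).out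
  have hrep : ∀ y, ∃ j : ℤ, a ^ j • rep y = y := by
    intro y
    have h1 : (MulAction.orbitRel (Subgroup.zpowers a) Z) y (rep y) :=
      Setoid.symm' _ (Quotient.mk_out (s := MulAction.orbitRel (Subgroup.zpowers a) Z) y)
    obtain ⟨⟨_, j, rfl⟩, h2⟩ := h1
    exact ⟨j, h2⟩
  have hrep' : ∀ y (j : ℕ), rep (a ^ j • y) = rep y := by
    intro y j
    refine congrArg Quotient.out (Quotient.sound ?_)
    exact ⟨⟨a ^ j, Subgroup.npow_mem_zpowers a j⟩, rfl⟩
  let S : Set Z := {y | rep y = y}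
  have hS : ∀ y ∈ S, ∀ j : ℕ, 0 < j → j < k → a ^ j • y ∉ S := by
    intro y hy j h0 hj h
    have h1 : rep (a ^ j • y) = a ^ j • y := h
    rw [hrep', show rep y = y from hy] at h1
    exact hfree j h0 hj y h1.symm
  have hrepS : ∀ y, rep y ∈ S := by
    intro y
    exact congrArg Quotient.out (Quotient.out_eq _)
  obtain ⟨k, rfl⟩ : ∃ k', k = k' + 1 := ⟨k - 1, by omega⟩
  have htail : ∀ (X : Type v) [Group X] (v v' : Z → X), (∀ y, y ∉ S → v y = v' y) → ∀ y ∈ S,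
      orbitProd a v k (a • y) = orbitProd a v' k (a • y) := by
    intro X _ v v' h y hy
    refine orbitProd_congr fun i hi => h _ ?_
    rw [smul_smul, ← pow_succ]
    exact hS y hy (i + 1) (by omega) (by omega)
  have hall : ∀ (X : Type v) [Group X] (v : Z → X), (∀ y ∈ S, orbitProd a v (k + 1) y = 1) →
      ∀ y, orbitProd a v (k + 1) y = 1 := by
    intro X _ v h y
    obtain ⟨j, hj⟩ := hrep y
    rw [← hj]
    have h0 := h _ (hrepS y)
    clear hj
    induction j with
    | zero => simpa using h0
    | succ j ih =>
      rwa [add_comm (j : ℤ) 1, zpow_add, zpow_one, mul_smul, orbitProd_smul_eq_one_iff hk]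
    | pred j ih =>
      rwa [← orbitProd_smul_eq_one_iff hk, smul_smul, ← zpow_one_add, add_sub_cancel]
  refine ⟨S, fun X _ v₀ => ?_⟩
  refine ⟨fun y => if y ∈ S then (orbitProd a v₀ k (a • y))⁻¹ else v₀ y,
    ⟨fun y hy => if_neg hy, hall X _ fun y hy => ?_⟩, ?_⟩
  · rw [orbitProd_succ', htail X _ v₀ (fun z hz => if_neg hz) y hy, if_pos hy, mul_inv_cancel]
  · rintro v ⟨h1, h2⟩
    funext y
    split_ifs with hy
    · have h3 := h2 y
      rw [orbitProd_succ', htail X v v₀ h1 y hy] at h3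
      exact eq_inv_of_mul_eq_one_right h3
    · exact h1 y hy

end orbitProd

/-! ### Homomorphisms to a finite cyclic group -/

/-- The intersection of the kernels of all homomorphisms from `D` to `ℤ / k`. -/
def cyclicKernel {G : Type*} [Group G] (D : Subgroup G) (k : ℕ) : Subgroup G where
  carrier := {g | ∃ hg : g ∈ D, ∀ h : D →* Multiplicative (ZMod k), h ⟨g, hg⟩ = 1}
  one_mem' := ⟨D.one_mem, fun h => h.map_one⟩
  mul_mem' := by
    rintro a b ⟨ha, ha'⟩ ⟨hb, hb'⟩
    refine ⟨D.mul_mem ha hb, fun h => ?_⟩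
    have := h.map_mul ⟨a, ha⟩ ⟨b, hb⟩
    rwa [ha', hb', one_mul] at this
  inv_mem' := by
    rintro a ⟨ha, ha'⟩
    refine ⟨D.inv_mem ha, fun h => ?_⟩
    have := h.map_inv ⟨a, ha⟩
    rwa [ha', inv_one] at this

section cyclicKernel

variable {G : Type*} [Group G] (D : Subgroup G) (k : ℕ)

theorem cyclicKernel_le : cyclicKernel D k ≤ D := fun _ h => h.1

instance cyclicKernel_normal [D.Normal] : (cyclicKernel D k).Normal := ⟨by
  rintro g ⟨hg, hg'⟩ a
  exact ⟨‹D.Normal›.conj_mem g hg a,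
    fun h => hg' (h.comp (MulAut.conjNormal (H := D) a).toMonoidHom)⟩⟩

theorem commutator_le_cyclicKernel : ⁅D, D⁆ ≤ cyclicKernel D k := by
  intro g hg
  have hgD := Subgroup.commutator_le_self D hg
  refine ⟨hgD, fun h => ?_⟩
  rw [← Subgroup.map_subtype_commutator] at hg
  obtain ⟨c, hc, hcg⟩ := hg
  have h1 : h c = 1 := Abelianization.commutator_subset_ker h hc
  rwa [show c = ⟨g, hgD⟩ from Subtype.ext hcg] at h1

theorem cyclicKernel_one : cyclicKernel D 1 = D :=
  le_antisymm (cyclicKernel_le D 1) fun _ hg => ⟨hg, fun _ => Subsingleton.elim _ _⟩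

end cyclicKernel

theorem derivedSeries_succ_le_cyclicKernel (G : Type*) [Group G] (m k : ℕ) :
    derivedSeries G (m + 1) ≤ cyclicKernel (rationalDerivedSeries G m) k :=
  (Subgroup.commutator_mono (derivedSeries_le_rationalDerivedSeries G m)
    (derivedSeries_le_rationalDerivedSeries G m)).trans (commutator_le_cyclicKernel _ k)

theorem isSolvable_quotient_cyclicKernel (G : Type*) [Group G] (m k : ℕ) :
    Group.IsSolvable (G ⧸ cyclicKernel (rationalDerivedSeries G m) k) := by
  refine ⟨⟨m + 1, ?_⟩⟩
  rw [← map_derivedSeries_eq (QuotientGroup.mk'_surjective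
    (cyclicKernel (rationalDerivedSeries G m) k)), Subgroup.map_eq_bot_iff, QuotientGroup.ker_mk']
  exact derivedSeries_succ_le_cyclicKernel G m k

/-- If the relator is the `k`-th power of an element describing a simple path in the Cayley graph of
a quotient by `rationalDerivedSeries G m`, some homomorphism from `rationalDerivedSeries G m` to
`ℤ / k` sends this element to a generator. -/
theorem exists_monoidHom_zmod {α G : Type*} [Group G] {f : FreeGroup α →* G}
    (hf : Function.Surjective f) {c : ℕ → α} {m d k : ℕ} (hd : 0 < d)
    (hker : f.ker = Subgroup.normalClosure {genProd c d ^ k})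
    (hu : f (genProd c d) ∈ rationalDerivedSeries G m)
    (hsimple : ∀ a b, a < b → b < d →
      (f (genProd c a) : G ⧸ rationalDerivedSeries G m) ≠ f (genProd c b)) :
    ∃ h : rationalDerivedSeries G m →* Multiplicative (ZMod k),
      h ⟨_, hu⟩ = Multiplicative.ofAdd 1 := by
  obtain ⟨R, hR⟩ := exists_free_labels.{0} f hd hsimple _ le_rfl
  obtain ⟨ℓ, ⟨-, hℓ⟩, -⟩ := hR (Multiplicative (ZMod k)) 1 (fun _ => Multiplicative.ofAdd 1)
  obtain ⟨κ, hκ, hκℓ⟩ := exists_isCocycle_freeGroup f ℓ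
  have hκu : ∀ y, κ (genProd c d) y = Multiplicative.ofAdd 1 := fun y => by
    rw [cocycle_genProd hκ hκℓ, hℓ]
  have hpow : ∀ (j : ℕ) y, κ (genProd c d ^ j) y = Multiplicative.ofAdd (j : ZMod k) := by
    intro j y
    induction j with
    | zero =>
      have := hκ 1 1 y
      rw [map_one, one_smul, mul_one] at this
      rw [pow_zero, Nat.cast_zero, ofAdd_zero]
      exact mul_eq_left.1 this.symm
    | succ j ih => rw [pow_succ', hκ, hκu, ih, ← ofAdd_add, Nat.cast_succ, add_comm]
  obtain ⟨κ', hκ', hκκ'⟩ := exists_isCocycle hf hker hκ (fun y => by rw [hpow]; simp)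
  exact ⟨hκ'.restrict 1, (congrFun (hκκ' _) 1).trans (hκu 1)⟩

/-! ### Free subgroups from free cocycles -/

section FreeGroupoid

open CategoryTheory

universe u

/-- The action groupoid of a group `G` acting on `Z`, whose objects are the points of `Z`, and whose
arrows from `a` to `b` are the elements of `G` that move `a` to `b`. (Mathlib's
`CategoryTheory.ActionCategory` gives access to its objects and arrows only through several
definitions.) -/
structure ActionGroupoid (G Z : Type u) where
  /-- The point of `Z` that is the given object. -/
  pt : Z

variable {G Z X : Type u} [Group G] [MulAction G Z] [Group X]

instance : Groupoid.{u} (ActionGroupoid G Z) where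
  Hom a b := {g : G // g • a.pt = b.pt}
  id a := ⟨1, one_smul G a.pt⟩
  comp f g := ⟨g.1 * f.1, by rw [mul_smul, f.2, g.2]⟩
  id_comp f := Subtype.ext (mul_one f.1)
  comp_id f := Subtype.ext (one_mul f.1)
  assoc f g h := Subtype.ext (mul_assoc h.1 g.1 f.1).symm
  inv f := ⟨f.1⁻¹, by rw [inv_smul_eq_iff]; exact f.2.symm⟩
  inv_comp f := Subtype.ext (mul_inv_cancel f.1)
  comp_inv f := Subtype.ext (inv_mul_cancel f.1)

namespace ActionGroupoid

/-- The arrow from `y` to `g • y` that is given by `g`. -/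
def arrow (g : G) (y : Z) : (⟨y⟩ : ActionGroupoid G Z) ⟶ ⟨g • y⟩ :=
  ⟨g, rfl⟩

theorem arrow_cases {p : ∀ {a b : ActionGroupoid G Z}, (a ⟶ b) → Prop}
    (h : ∀ (g : G) (y : Z), p (arrow g y)) {a b : ActionGroupoid G Z} (f : a ⟶ b) : p f := by
  obtain ⟨a⟩ := a
  obtain ⟨b⟩ := b
  obtain ⟨g, hg⟩ := f
  change g • a = b at hg
  subst hg
  exact h g a

/-- The functor from the action groupoid to a group that is given by a cocycle. -/
def functor {κ : G → Z → X} (hκ : IsCocycle κ) : ActionGroupoid G Z ⥤ SingleObj X where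
  obj _ := ()
  map {a _} f := κ f.1 a.pt
  map_id a := hκ.map_one a.pt
  map_comp {a b _} f g := (hκ g.1 f.1 a.pt).trans (by rw [f.2]; rfl)

theorem isCocycle_map_arrow (F : ActionGroupoid G Z ⥤ SingleObj X) :
    IsCocycle (X := X) (fun (g : G) (y : Z) => F.map (arrow g y)) := by
  intro g h y
  refine Eq.trans ?_ (F.map_comp (arrow h y) (arrow g (h • y)))
  have : ∀ (z z' : Z), z = z' → ∀ (e : (⟨y⟩ : ActionGroupoid G Z) ⟶ ⟨z⟩)
      (e' : (⟨y⟩ : ActionGroupoid G Z) ⟶ ⟨z'⟩), e.1 = e'.1 → (F.map e : X) = (F.map e' : X) := by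
    rintro z _ rfl e e' hee
    rw [Subtype.ext hee]
  exact this _ _ (mul_smul g h y) _ _ rfl

instance [MulAction.IsPretransitive G Z] [Nonempty Z] : IsConnected (ActionGroupoid G Z) :=
  have : Nonempty (ActionGroupoid G Z) := ⟨⟨Classical.arbitrary Z⟩⟩
  zigzag_isConnected fun x y => Relation.ReflTransGen.single <| Or.inl <| by
    obtain ⟨g, hg⟩ := MulAction.exists_smul_eq G x.pt y.pt
    exact ⟨⟨g, hg⟩⟩

/-- The vertex groups of the action groupoid are the stabilizers. -/
def endEquiv (y : Z) : End (⟨y⟩ : ActionGroupoid G Z) ≃* MulAction.stabilizer G y where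
  toFun f := ⟨f.1, f.2⟩
  invFun g := ⟨g.1, g.2⟩
  left_inv _ := rfl
  right_inv _ := rfl
  map_mul' _ _ := rfl

end ActionGroupoid

/-- Let `valid` be a set of arrows `y ⟶ elt s • y` of the action groupoid of `G` on `G ⧸ M`. If
arbitrary labels of these arrows extend uniquely to a cocycle, the action groupoid is free on them,
and `M`, as one of its vertex groups, is a free group. -/
theorem isFreeGroup_of_free_cocycles (M : Subgroup G) {σ : Type u} (elt : σ → G)
    (valid : σ → G ⧸ M → Prop)
    (h : ∀ (X : Type u) [Group X] (l : σ → G ⧸ M → X), ∃! κ : G → G ⧸ M → X,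
      IsCocycle κ ∧ ∀ s y, valid s y → κ (elt s) y = l s y) : IsFreeGroup M := by
  classical
  let _ : IsFreeGroupoid (ActionGroupoid G (G ⧸ M)) :=
    { quiverGenerators :=
        ⟨fun (a b : ActionGroupoid G (G ⧸ M)) => {s : σ // valid s a.pt ∧ elt s • a.pt = b.pt}⟩
      of := fun e => ⟨elt e.1, e.2.2⟩
      unique_lift := by
        intro X _ f
        obtain ⟨κ, ⟨hκ, hκl⟩, hκu⟩ := h X (fun s y =>
          if hv : valid s y then @f ⟨y⟩ ⟨elt s • y⟩ ⟨s, hv, rfl⟩ else 1)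
        refine ⟨ActionGroupoid.functor hκ, ?_, fun F hF => ?_⟩
        · rintro ⟨a⟩ ⟨b⟩ ⟨s, hv, hb⟩
          change elt s • a = b at hb
          subst hb
          change κ (elt s) a = _
          rw [hκl s a hv]
          exact dif_pos hv
        · have hFκ : (fun (g : G) (y : G ⧸ M) => (F.map (ActionGroupoid.arrow g y) : X)) = κ := by
            refine hκu _ ⟨ActionGroupoid.isCocycle_map_arrow F, fun s y hv => ?_⟩
            rw [dif_pos hv]
            exact hF ⟨y⟩ ⟨elt s • y⟩ ⟨s, hv, rfl⟩
          refine CategoryTheory.Functor.hext (fun _ => rfl) fun a b g => heq_of_eq ?_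
          refine ActionGroupoid.arrow_cases
            (p := fun {a b} g => F.map g = (ActionGroupoid.functor hκ).map g) (fun g y => ?_) g
          exact congrFun (congrFun hFκ g) y }
  have hstab : MulAction.stabilizer G ((1 : G) : G ⧸ M) = M := MulAction.stabilizer_quotient M
  exact IsFreeGroup.ofMulEquiv ((ActionGroupoid.endEquiv ((1 : G) : G ⧸ M)).trans
    (MulEquiv.subgroupCongr hstab))

end FreeGroupoid

/-- If the relator is the `k`-th power of an element describing a simple path in the Cayley graph of
the quotient by `D = rationalDerivedSeries G m`, then `cyclicKernel D k` is a free group: labels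
of the arrows of this element that give the relator label `1` can be prescribed at all points but
one of each orbit, and determine the labels of one generator in terms of free labels. -/
theorem isFreeGroup_cyclicKernel.{u} {α G : Type u} [Group G] {f : FreeGroup α →* G}
    (hf : Function.Surjective f) {c : ℕ → α} {m d k : ℕ} (hd : 0 < d) (hk : 0 < k)
    (hker : f.ker = Subgroup.normalClosure {genProd c d ^ k})
    (hu : f (genProd c d) ∈ rationalDerivedSeries G m)
    (hsimple : ∀ a b, a < b → b < d →
      (f (genProd c a) : G ⧸ rationalDerivedSeries G m) ≠ f (genProd c b)) :
    IsFreeGroup (cyclicKernel (rationalDerivedSeries G m) k) := by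
  classical
  set M := cyclicKernel (rationalDerivedSeries G m) k with hM
  set u := f (genProd c d) with hu_def
  have hfix : ∀ (j : ℕ) (y : G ⧸ M), u ^ j • y = y ↔ u ^ j ∈ M := by
    intro j y
    rw [smul_quotient_eq_mul, mul_eq_right, QuotientGroup.eq_one_iff]
  have hfree : ∀ j : ℕ, 0 < j → j < k → ∀ y : G ⧸ M, u ^ j • y ≠ y := by
    intro j hj hjk y h
    obtain ⟨hmem, h1⟩ := (hfix j y).1 h
    obtain ⟨φ, hφ⟩ := exists_monoidHom_zmod hf hd hker hu hsimple
    have h2 := h1 φ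
    rw [show (⟨u ^ j, hmem⟩ : rationalDerivedSeries G m) = ⟨u, hu⟩ ^ j from rfl, map_pow, hφ,
      ← ofAdd_nsmul, nsmul_one] at h2
    have h3 : (j : ZMod k) = 0 := h2
    rw [ZMod.natCast_eq_zero_iff] at h3
    exact absurd (Nat.le_of_dvd hj h3) (by omega)
  have huk : u ^ k = 1 := by
    rw [hu_def, ← map_pow, ← MonoidHom.mem_ker, hker]
    exact Subgroup.subset_normalClosure rfl
  obtain ⟨S, hS⟩ := exists_free_orbit_labels.{u} (Z := G ⧸ M) u hk hfree
    (fun y => by rw [huk, one_smul])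
  obtain ⟨R, hR⟩ := exists_free_labels.{u} f hd hsimple M (cyclicKernel_le _ _)
  -- the generating arrows are those of the letters, except for `c 0` outside `R`, and those of the
  -- root `u` outside `S`
  refine isFreeGroup_of_free_cocycles M (σ := Option α)
    (fun s => s.elim u fun s => f (FreeGroup.of s))
    (fun s y => s.elim (y ∉ S) fun s => s ≠ c 0 ∨ y ∈ R) fun X _ l => ?_
  obtain ⟨v, ⟨hv₀, hv⟩, hvu⟩ := hS X (l none)
  obtain ⟨ℓ, ⟨hℓ₀, hℓ⟩, hℓu⟩ := hR X (fun s => l (some s)) v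
  obtain ⟨κ, hκ, hκℓ⟩ := exists_isCocycle_freeGroup f ℓ
  have hκu : ∀ y, κ (genProd c d) y = v y := fun y => by rw [cocycle_genProd hκ hκℓ, hℓ]
  have hpow : ∀ (j : ℕ) y, κ (genProd c d ^ j) y = orbitProd u v j y := by
    intro j y
    induction j with
    | zero =>
      have := hκ 1 1 y
      rw [map_one, one_smul, mul_one] at this
      rw [pow_zero, orbitProd]
      exact mul_eq_left.1 this.symm
    | succ j ih => rw [pow_succ', hκ, hκu, ih, orbitProd, map_pow]
  obtain ⟨κ', hκ', hκκ'⟩ := exists_isCocycle hf hker hκ (fun y => by rw [hpow, hv])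
  refine ⟨κ', ⟨hκ', ?_⟩, ?_⟩
  · rintro (_ | s) y hy
    · exact (congrFun (hκκ' _) y).trans ((hκu y).trans (hv₀ y hy))
    · change κ' (f (FreeGroup.of s)) y = _
      rw [hκκ', hκℓ]
      exact hℓ₀ s y hy
  · rintro κ₂ ⟨hκ₂, hκ₂l⟩
    have hv₂ : κ₂ u = v := by
      refine hvu _ ⟨fun y hy => hκ₂l none y hy, fun y => ?_⟩
      rw [← hκ₂.map_pow, huk, hκ₂.map_one]
    have hℓ₂ : (fun s => κ₂ (f (FreeGroup.of s))) = ℓ := by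
      refine hℓu _ ⟨fun s y h => hκ₂l (some s) y h, fun y => ?_⟩
      rw [← cocycle_genProd (κ := fun v => κ₂ (f v)) (fun v w x => by rw [map_mul, hκ₂])
        (fun s => rfl), ← hv₂]
    refine hκ₂.eq_of_forall_generator hκ' hf fun s => ?_
    rw [hκκ', hκℓ, ← hℓ₂]

/-! ### Free groups are residually `ℚ`-solvable -/

/-- The letter `(s, true)` stands for the generator `s`, the letter `(s, false)` for its inverse. -/
def signedLetters (β : Type*) : FreeGroup (β × Bool) →* FreeGroup β :=
  FreeGroup.lift fun a => cond a.2 (FreeGroup.of a.1) (FreeGroup.of a.1)⁻¹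

theorem exists_reduced_genProd {β : Type*} {v : FreeGroup β} (hv : v ≠ 1) :
    ∃ (c : ℕ → β × Bool) (n : ℕ), 0 < n ∧ v = signedLetters β (genProd c n) ∧
      ∀ t, t + 1 < n → (c t).1 = (c (t + 1)).1 → (c t).2 = (c (t + 1)).2 := by
  classical
  set L := v.toWord with hL
  have hred : FreeGroup.IsReduced L := FreeGroup.isReduced_toWord
  have hne : L ≠ [] := fun h => hv (FreeGroup.toWord_eq_nil_iff.1 h)
  let x₀ := L.head hne
  let c : ℕ → β × Bool := fun t => L.getD (L.length - 1 - t) x₀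
  have hc : ∀ t (ht : t < L.length), c t = L[L.length - 1 - t] := fun t ht =>
    List.getD_eq_getElem _ _ _
  refine ⟨c, L.length, List.length_pos_of_ne_nil hne, ?_, fun t ht h => ?_⟩
  · have key : ∀ t ≤ L.length, signedLetters β (genProd c t) =
        ((L.drop (L.length - t)).map
          fun x => cond x.2 (FreeGroup.of x.1) (FreeGroup.of x.1)⁻¹).prod := by
      intro t ht
      induction t with
      | zero => simp [genProd]
      | succ t ih =>
        have h1 : L.length - (t + 1) < L.length := by omega
        have h2 : L.length - (t + 1) = L.length - 1 - t := by omega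
        have h3 : L.length - (t + 1) + 1 = L.length - t := by omega
        rw [List.drop_eq_getElem_cons h1, h3, List.map_cons, List.prod_cons, ← ih (by omega),
          genProd, map_mul, hc t (by omega)]
        simp only [h2, signedLetters, FreeGroup.lift_apply_of]
    rw [key _ le_rfl, Nat.sub_self, List.drop_zero, ← FreeGroup.lift_mk, hL, FreeGroup.mk_toWord]
    exact (DFunLike.congr_fun (FreeGroup.lift_of_eq_id β) v).symm
  · rw [hc t (by omega), hc (t + 1) (by omega)] at h ⊢
    have h1 := List.isChain_iff_getElem.1 hred (L.length - 1 - (t + 1)) (by omega)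
    have h2 : L.length - 1 - (t + 1) + 1 = L.length - 1 - t := by omega
    simp only [h2] at h1
    exact (h1 h.symm).symm

/-- A reduced word in all terms of the rational derived series describes a closed path in the Cayley
graph of the quotient by any term. If a shortest closed subpath is trivial in the quotient by the
next term, labelling its first edge by `1`, and all other edges by `0`, gives a contradiction. -/
theorem isResiduallyRationallySolvable_freeGroup (β : Type*) :
    IsResiduallyRationallySolvable (FreeGroup β) := by
  classical
  refine (Subgroup.eq_bot_iff_forall _).2 fun v hv => ?_
  by_contra hv1
  obtain ⟨c, n, hn, rfl, hred⟩ := exists_reduced_genProd hv1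
  set f := signedLetters β with hf
  have hft : ∀ s, f (FreeGroup.of (s, true)) = FreeGroup.of s := fun s => by
    simp [hf, signedLetters]
  have hff : ∀ s, f (FreeGroup.of (s, false)) = (FreeGroup.of s)⁻¹ := fun s => by
    simp [hf, signedLetters]
  obtain ⟨m, hm⟩ := exists_mem_rationalDerivedSeries_succ
    ((Finset.range (n + 1) ×ˢ Finset.range (n + 1)).image
      fun q => f (genProd c q.2) * (f (genProd c q.1))⁻¹)
  let Γ := FreeGroup β ⧸ rationalDerivedSeries (FreeGroup β) m
  let g : ℕ → Γ := fun t => (f (genProd c t) : FreeGroup β)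
  have hgsucc : ∀ t, g (t + 1) = (f (FreeGroup.of (c t)) : FreeGroup β) • g t := by
    intro t
    simp only [g]
    rw [genProd, map_mul]
    rfl
  have hex : ∃ d, 0 < d ∧ ∃ i, i + d ≤ n ∧ g i = g (i + d) := by
    refine ⟨n, hn, 0, by omega, ?_⟩
    have h1 : f (genProd c n) ∈ rationalDerivedSeries (FreeGroup β) m :=
      (Subgroup.mem_iInf.1 hv) m
    have h2 : g n = 1 := (QuotientGroup.eq_one_iff _).2 h1
    rw [zero_add, h2]
    simp [g, genProd]
  obtain ⟨hd0, i, hin, hclosed⟩ := Nat.find_spec hex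
  set d := Nat.find hex with hd
  have hinj : ∀ a b, i ≤ a → a < b → b < i + d → g a ≠ g b := by
    intro a b ha hab hb h
    refine Nat.find_min hex (m := b - a) (by omega) ⟨by omega, a, by omega, ?_⟩
    rwa [Nat.add_sub_cancel' hab.le]
  have hz : f (genProd c (i + d)) * (f (genProd c i))⁻¹ ∈
      rationalDerivedSeries (FreeGroup β) (m + 1) := by
    refine hm _ (Finset.mem_image.2 ⟨(i, i + d), by simp; omega, rfl⟩) ?_
    rw [← QuotientGroup.eq_one_iff, QuotientGroup.mk_mul, QuotientGroup.mk_inv, mul_inv_eq_one]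
    exact hclosed.symm
  -- the edge of the `i`-th step, with the orientation of its generator, starts at `e`
  let e : Γ := if (c i).2 = true then g i else g (i + 1)
  let ℓ : β → Γ → Multiplicative ℚ := fun s y =>
    Multiplicative.ofAdd (if s = (c i).1 ∧ y = e then 1 else 0)
  obtain ⟨κ, hκ, hκℓ⟩ := exists_isCocycle_freeGroup (MonoidHom.id (FreeGroup β)) ℓ
  have hκc : IsCocycle κ := hκ
  have hzero := hκc.eq_one_of_mem_rationalDerivedSeries hz (f (genProd c i) • 1)
  rw [hκc.map_mul_inv] at hzero
  have hsum := cocycle_genProd_eq_sum (f := f) (κ := fun v => κ (f v))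
    (ℓ := fun s => κ (f (FreeGroup.of s))) (fun v w x => by rw [map_mul, hκc]) (fun s => rfl) c
  have hg : ∀ τ, f (genProd c τ) • (1 : Γ) = g τ := fun τ => by
    rw [smul_quotient_eq_mul, mul_one]
  have hzero' := congrArg Multiplicative.toAdd hzero
  rw [← div_eq_mul_inv, toAdd_div, hsum, hsum, toAdd_one,
    ← Finset.sum_Ico_eq_sub _ (Nat.le_add_right i d)] at hzero'
  simp only [hg] at hzero'
  have hfalse : ∀ s y, κ (f (FreeGroup.of (s, false))) y = (ℓ s ((FreeGroup.of s)⁻¹ • y))⁻¹ := by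
    intro s y
    rw [hff, hκc.map_inv, hκℓ]
  have htrue : ∀ s y, κ (f (FreeGroup.of (s, true))) y = ℓ s y := by
    intro s y
    rw [hft, hκℓ]
  obtain ⟨s, ε, hci⟩ : ∃ s ε, c i = (s, ε) := ⟨(c i).1, (c i).2, rfl⟩
  rw [Finset.sum_eq_single i] at hzero'
  · cases ε with
    | true =>
      have he : e = g i := by simp [e, hci]
      rw [hci, htrue] at hzero'
      simp [ℓ, hci, he] at hzero'
    | false =>
      have he : e = (FreeGroup.of s)⁻¹ • g i := by
        have := hgsucc i
        rw [hci, hff] at this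
        simp [e, hci, this]
      rw [hci, hfalse] at hzero'
      simp [ℓ, hci, he] at hzero'
  · intro τ hτ hτi
    rw [Finset.mem_Ico] at hτ
    obtain ⟨s', ε', hcτ⟩ : ∃ s ε, c τ = (s, ε) := ⟨(c τ).1, (c τ).2, rfl⟩
    -- otherwise the step `τ` follows the step `i` and is inverse to it
    have hnext : g τ = g (i + 1) → s' = s → ε' = ε := by
      intro h hs
      have hτ1 : τ = i + 1 := by
        by_contra hne
        exact hinj (i + 1) τ (by omega) (by omega) hτ.2 h.symm
      subst hτ1
      have := hred i (by omega)
      rw [hci, hcτ] at this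
      exact (this hs.symm).symm
    have hne : g τ ≠ g i := fun h => hinj i τ le_rfl (by omega) hτ.2 h.symm
    have hstep : g (i + 1) = f (FreeGroup.of (s, ε)) • g i := by rw [hgsucc, hci]
    cases ε' with
    | true =>
      rw [hcτ, htrue]
      have : ¬ (s' = (c i).1 ∧ g τ = e) := by
        rintro ⟨h1, h2⟩
        rw [hci] at h1
        cases ε with
        | true => exact hne (by simpa [e, hci] using h2)
        | false => exact absurd (hnext (by simpa [e, hci] using h2) h1) (by simp)
      simp [ℓ, this]
    | false =>
      rw [hcτ, hfalse]
      have : ¬ (s' = (c i).1 ∧ (FreeGroup.of s')⁻¹ • g τ = e) := by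
        rintro ⟨h1, h2⟩
        rw [hci] at h1
        dsimp only at h1
        subst h1
        cases ε with
        | true =>
          have h3 : (FreeGroup.of s')⁻¹ • g τ = g i := by simpa [e, hci] using h2
          rw [inv_smul_eq_iff] at h3
          exact absurd (hnext (by rw [hstep, hft, h3]) rfl) (by simp)
        | false =>
          have h3 : (FreeGroup.of s')⁻¹ • g τ = g (i + 1) := by simpa [e, hci] using h2
          rw [hstep, hff] at h3
          exact hne (smul_left_cancel _ h3)
      simp [ℓ, this]
  · intro h
    exact (h (Finset.mem_Ico.2 ⟨le_rfl, by omega⟩)).elim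

/-! ### Residual properties and invariance under isomorphism -/

theorem IsResiduallyRationallySolvable.of_injective {G H : Type*} [Group G] [Group H]
    (h : IsResiduallyRationallySolvable H) (f : G →* H) (hf : Function.Injective f) :
    IsResiduallyRationallySolvable G := by
  refine (Subgroup.eq_bot_iff_forall _).2 fun g hg => hf ?_
  have : f g ∈ ⨅ n, rationalDerivedSeries H n :=
    Subgroup.mem_iInf.2 fun n => map_mem_rationalDerivedSeries f (Subgroup.mem_iInf.1 hg n)
  rw [h, Subgroup.mem_bot] at this
  rw [this, map_one]

theorem IsResiduallySolvable.of_injective {G H : Type*} [Group G] [Group H]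
    (h : IsResiduallySolvable H) (f : G →* H) (hf : Function.Injective f) :
    IsResiduallySolvable G := by
  refine (Subgroup.eq_bot_iff_forall _).2 fun g hg => hf ?_
  have : f g ∈ ⨅ n, derivedSeries H n :=
    Subgroup.mem_iInf.2 fun n =>
      map_derivedSeries_le_derivedSeries f n (Subgroup.mem_map_of_mem f (Subgroup.mem_iInf.1 hg n))
  rw [h, Subgroup.mem_bot] at this
  rw [this, map_one]

theorem isResiduallyRationallySolvable_of_isFreeGroup (G : Type*) [Group G] [IsFreeGroup G] :
    IsResiduallyRationallySolvable G :=
  (isResiduallyRationallySolvable_freeGroup _).of_injective (IsFreeGroup.toFreeGroup G).toMonoidHom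
    (IsFreeGroup.toFreeGroup G).injective

theorem IsResiduallyRationallySolvable.of_le {G : Type*} [Group G] {N : Subgroup G} {m : ℕ}
    (hN : rationalDerivedSeries G m ≤ N) (h : IsResiduallyRationallySolvable N) :
    IsResiduallyRationallySolvable G := by
  have key : ∀ j, rationalDerivedSeries G (m + j) ≤ (rationalDerivedSeries N j).map N.subtype := by
    intro j
    induction j with
    | zero => exact fun g hg => ⟨⟨g, hN hg⟩, Subgroup.mem_top _, rfl⟩
    | succ j ih =>
      intro g hg
      obtain ⟨k, hk, hgk⟩ := (mem_rationalDerivedSeries_succ (m + j) g).1 hg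
      have hgN : g ∈ N := hN (rationalDerivedSeries_antitone G (by omega) hg)
      have h1 := Subgroup.commutator_mono ih ih hgk
      rw [← Subgroup.map_commutator] at h1
      obtain ⟨x, hx, hxg⟩ := h1
      refine ⟨⟨g, hgN⟩, (mem_rationalDerivedSeries_succ j _).2 ⟨k, hk, ?_⟩, rfl⟩
      rwa [show (⟨g, hgN⟩ : N) ^ k = x from Subtype.ext hxg.symm]
  refine (Subgroup.eq_bot_iff_forall _).2 fun g hg => ?_
  have hg' := Subgroup.mem_iInf.1 hg
  have hmem : (⟨g, hN (hg' m)⟩ : N) ∈ ⨅ n, rationalDerivedSeries N n := by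
    refine Subgroup.mem_iInf.2 fun j => ?_
    obtain ⟨x, hx, hxg⟩ := key j (hg' (m + j))
    rwa [show (⟨g, hN (hg' m)⟩ : N) = x from Subtype.ext hxg.symm]
  rw [h, Subgroup.mem_bot] at hmem
  exact congrArg Subtype.val hmem

theorem IsResiduallyRationallySolvable.isResiduallySolvable_of_le {G : Type*} [Group G]
    {N : Subgroup G} {m : ℕ} (hN : derivedSeries G m ≤ N)
    (h : IsResiduallyRationallySolvable N) : IsResiduallySolvable G := by
  have key : ∀ j, derivedSeries G (m + j) ≤ (derivedSeries N j).map N.subtype := by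
    intro j
    induction j with
    | zero => exact fun g hg => ⟨⟨g, hN hg⟩, Subgroup.mem_top _, rfl⟩
    | succ j ih =>
      refine (Subgroup.commutator_mono ih ih).trans ?_
      rw [← Subgroup.map_commutator]
      rfl
  refine (Subgroup.eq_bot_iff_forall _).2 fun g hg => ?_
  have hg' := Subgroup.mem_iInf.1 hg
  have hmem : (⟨g, hN (hg' m)⟩ : N) ∈ ⨅ n, rationalDerivedSeries N n := by
    refine Subgroup.mem_iInf.2 fun j => ?_
    obtain ⟨x, hx, hxg⟩ := key j (hg' (m + j))
    rw [show (⟨g, hN (hg' m)⟩ : N) = x from Subtype.ext hxg.symm]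
    exact derivedSeries_le_rationalDerivedSeries N j hx
  rw [h, Subgroup.mem_bot] at hmem
  exact congrArg Subtype.val hmem

section MulEquiv

variable {G H : Type*} [Group G] [Group H]

theorem isFreeGroup_of_mulEquiv (e : G ≃* H) (h : IsFreeGroup G) : IsFreeGroup H :=
  ((IsFreeGroup.basis G).map e).isFreeGroup

theorem quotient_map_comap_injective (e : G ≃* H) (N : Subgroup H) [N.Normal] :
    Function.Injective (QuotientGroup.map (N.comap e.toMonoidHom) N e.toMonoidHom le_rfl) := by
  rw [injective_iff_map_eq_one]
  intro q
  induction q using QuotientGroup.induction_on with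
  | H g =>
    intro hq
    exact (QuotientGroup.eq_one_iff g).2 ((QuotientGroup.eq_one_iff (e g)).1 hq)

theorem isFreeGroup_comap (e : G ≃* H) (N : Subgroup H) (h : IsFreeGroup N) :
    IsFreeGroup (N.comap e.toMonoidHom) :=
  isFreeGroup_of_mulEquiv (e.symm.subgroupMap N |>.trans
    (MulEquiv.subgroupCongr (Subgroup.map_equiv_eq_comap_symm e.symm N))) h

theorem IsFreeByRationallySolvable.of_mulEquiv (e : G ≃* H) :
    IsFreeByRationallySolvable H → IsFreeByRationallySolvable G := by
  rintro ⟨N, hN, hfree, n, hn⟩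
  exact ⟨N.comap e.toMonoidHom, inferInstance, isFreeGroup_comap e N hfree, n,
    rationalDerivedSeries_eq_bot_of_injective _ (quotient_map_comap_injective e N) hn⟩

theorem IsFreeBySolvable.of_mulEquiv (e : G ≃* H) : IsFreeBySolvable H → IsFreeBySolvable G := by
  rintro ⟨N, hN, hfree, hn⟩
  exact ⟨N.comap e.toMonoidHom, inferInstance, isFreeGroup_comap e N hfree,
    Group.isSolvable_of_isSolvable_injective (quotient_map_comap_injective e N)⟩

theorem IsTorsionFreeGroup.of_mulEquiv (e : G ≃* H) (h : IsTorsionFreeGroup G) :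
    IsTorsionFreeGroup H := by
  intro g hg
  have := h (e.symm g) (e.symm.toMonoidHom.isOfFinOrder hg)
  simpa using this

end MulEquiv

/-! ### Positive one-relator groups -/

/-- A positive one-relator group has a free subgroup that is the intersection of the kernels of all
homomorphisms to `ℤ / k` from some term of the rational derived series, with `k = 1` if the group
is torsion-free. -/
theorem exists_isFreeGroup_cyclicKernel.{u} {α : Type u} {w : FreeGroup α}
    (hw : IsPositiveWord w) :
    ∃ m k : ℕ,
      IsFreeGroup (cyclicKernel (rationalDerivedSeries (PresentedGroup {w}) m) k) ∧
        (IsTorsionFreeGroup (PresentedGroup {w}) → k = 1) := by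
  have hf := PresentedGroup.mk_surjective {w}
  have hker : (PresentedGroup.mk {w}).ker = Subgroup.normalClosure {w} := QuotientGroup.ker_mk' _
  by_cases h1 : w = 1
  · refine ⟨0, 1, ?_, fun _ => rfl⟩
    rw [cyclicKernel_one]
    have hinj : Function.Injective (PresentedGroup.mk {w}) := by
      rw [← MonoidHom.ker_eq_bot_iff, hker, h1]
      simp
    exact isFreeGroup_of_mulEquiv ((MulEquiv.ofBijective _ ⟨hinj, hf⟩).trans
      Subgroup.topEquiv.symm) inferInstance
  · obtain ⟨c, n, hn, rfl⟩ := exists_genProd hw h1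
    obtain ⟨m, d, k, hd, hk, hpow, hu, hsimple⟩ := exists_simple_root hf hn hker
    replace hker := hker.trans (congrArg (fun x => Subgroup.normalClosure {x}) hpow)
    refine ⟨m, k, isFreeGroup_cyclicKernel hf hd hk hker hu hsimple, fun htf => ?_⟩
    have huk : PresentedGroup.mk {genProd c n} (genProd c d) ^ k = 1 := by
      rw [← map_pow, ← MonoidHom.mem_ker, hker]
      exact Subgroup.subset_normalClosure rfl
    have hu1 := htf _ (isOfFinOrder_iff_pow_eq_one.2 ⟨k, hk, huk⟩)
    obtain ⟨φ, hφ⟩ := exists_monoidHom_zmod hf hd hker hu hsimple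
    rw [show (⟨_, hu⟩ : rationalDerivedSeries (PresentedGroup {genProd c n}) m) = 1 from
      Subtype.ext hu1, map_one] at hφ
    have h2 : ((1 : ℕ) : ZMod k) = 0 := by
      rw [Nat.cast_one]
      exact (congrArg Multiplicative.toAdd hφ).symm
    rw [ZMod.natCast_eq_zero_iff] at h2
    exact Nat.dvd_one.1 h2

theorem corollary1p3 {α : Type*} {G : Type*} [Group G] (w : FreeGroup α)
    (hw : IsPositiveWord w) (e : G ≃* PresentedGroup ({w} : Set (FreeGroup α))) :
    (IsTorsionFreeGroup G →
      IsFreeByRationallySolvable G ∧ IsResiduallyRationallySolvable G) ∧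
    (¬ IsTorsionFreeGroup G →
      IsFreeBySolvable G ∧ IsResiduallySolvable G) := by
  obtain ⟨m, k, hfree, hk⟩ := exists_isFreeGroup_cyclicKernel hw
  have hres := isResiduallyRationallySolvable_of_isFreeGroup
    (cyclicKernel (rationalDerivedSeries (PresentedGroup {w}) m) k)
  refine ⟨fun htf => ?_, fun _ => ?_⟩
  · obtain rfl := hk (htf.of_mulEquiv e)
    rw [cyclicKernel_one] at hfree hres
    exact ⟨IsFreeByRationallySolvable.of_mulEquiv e
        ⟨_, inferInstance, hfree, m, rationalDerivedSeries_quotient _ m⟩,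
      (hres.of_le le_rfl).of_injective e.toMonoidHom e.injective⟩
  · refine ⟨IsFreeBySolvable.of_mulEquiv e
        ⟨_, inferInstance, hfree, isSolvable_quotient_cyclicKernel _ m k⟩,
      (hres.isResiduallySolvable_of_le (m := m + 1) ?_).of_injective e.toMonoidHom e.injective⟩
    exact derivedSeries_succ_le_cyclicKernel _ m k
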